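/- Let $S^2$ be the unit sphere with round metric $h_{AB}$, volume form $\epsilon_{AB}$ and Levi-Civita derivative $D_A=(\cdot)_{||A}$; put $D^2=D_AD^A$ and raise and lower indices with $h$. All integrals are over $S^2$ with the standard area measure, and all fields are smooth. The data on null infinity are, for retarded times $u$ in an open set $I\subseteq\mathbb R$, a symmetric traceless tensor field $\chi_{AB}$ (the shear), a function $m$ and a one-form $N_A$ on $S^2$, all depending on $(u,x^A)$; a dot denotes $\partial_u$. For a function $f$ on $S^2$, under the supertranslation $u\mapsto u-f(x^A)$ the data transform (all quantities being taken at the same point of null infinity) as $$\chi_{AB}\mapsto\chi_{AB}-2f_{||AB}+h_{AB}D^2f,$$ $$m\mapsto m+\tfrac12\dot\chi^{AB}{}_{||B}f_{||A}+\tfrac14\dot\chi^{AB}f_{||AB}+\tfrac14\ddot\chi^{AB}f_{||A}f_{||B},$$ $$N_A\mapsto N_A-mf_{||A}+\tfrac14f_{||C}\chi_{AB}{}^{||BC}-\tfrac14f_{||C}\chi^{CB}{}_{||BA}+\tfrac14\dot\chi_{AB}{}^{||B}f_{||C}f^{||C}-\tfrac14\dot\chi^{BC}\chi_{AB}f_{||C}-\tfrac16\ddot\chi^{BC}f_{||B}f_{||C}f_{||A}-\tfrac12\dot\chi^{BC}{}_{||C}f_{||B}f_{||A}+\tfrac1{12}\ddot\chi_{AB}f^{||B}f_{||C}f^{||C}.$$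 Let $n$ be a linear combination of the $l=1$ spherical harmonics. The proposed angular momentum at retarded time $u$ is $$J=-\frac1{8\pi}\int_{S^2}\Big(3N_A+\tfrac14\chi_{AB}\chi^{BC}{}_{||C}\Big)\epsilon^{AD}n_{||D}+\frac3{8\pi}\int_{S^2}m\,\epsilon^{AD}n_{||D}c_{||A},$$ where $c$ is the unique solution of $D^2(D^2+2)c=\chi_{AB}{}^{||BA}$ without $l=0,1$ parts. Let $c,b$ be the potentials of $\chi$ at time $u$, that is, the smooth functions without $l=0,1$ parts such that $$\chi_{AB}=2c_{||AB}-h_{AB}D^2c+\epsilon_{AC}b^{||C}{}_{||B}+\epsilon_{BC}b^{||C}{}_{||A}$$ (this $c$ is the one in the definition of $J$). **Theorem.** Suppose that $\dot\chi=0$ on $I$, that $f$ is smooth, and that $\int_{S^2} f\,n_{||A}D^AD^2(D^2+2)b=0$. If $f$ has no $l=1$ part (that is, $f$ contains no spatial translation), then $J$ is invariant under the supertranslation $u\mapsto u-f(x^A)$: its value at $u$ computed from the transformed data, including their own potential, equals its value computed from the original data. Moreover, for every smooth $f$ satisfying the orthogonality condition, with or without an $l=1$ part, the same equality holds if on the transformed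 side the potential $c$ is replaced by $c-f$. -/

import Mathlib

open MeasureTheory Set
open scoped Manifold ContDiff

noncomputable section

namespace NullInfinity

/-!
### Tensor calculus on the round unit sphere

Tensor fields on `S²` are written through their Cartesian components: a tensor field of rank `k` is
a function of the point and of `k` indices in `Fin 3` that is annihilated by the position vector in
each index.  In these components the round metric is the projection `δ i j - x i * x j`, raising an
index does nothing, and a contraction is a sum over `Fin 3`.
-/

/-- Euclidean three-space. -/
abbrev E3 := EuclideanSpace ℝ (Fin 3)

/-- The unit two-sphere in Euclidean three-space. -/
abbrev S2 := Metric.sphere (0 : E3) 1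

/-- A point of the sphere, used only as the value of `radial` at the origin. -/
def northPole : S2 := ⟨EuclideanSpace.single 2 1, by simp⟩

/-- Radial projection `y ↦ y / ‖y‖` onto the sphere (its value at `0` plays no role). -/
def radial (y : E3) : S2 :=
  if h : y = 0 then northPole
  else ⟨‖y‖⁻¹ • y, by
    rw [mem_sphere_zero_iff_norm, norm_smul, norm_inv, norm_norm,
      inv_mul_cancel₀ (norm_ne_zero_iff.mpr h)]⟩

/-- Smooth real functions on the sphere. -/
def Smooth (F : S2 → ℝ) : Prop := ContMDiff (𝓡 2) 𝓘(ℝ, ℝ) ∞ F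

/-- The `i`-th Cartesian component of the tangential gradient of `F`: the derivative at `x`, in the
direction of the `i`-th basis vector, of the extension of `F` that is constant along rays. -/
def pd (F : S2 → ℝ) (i : Fin 3) (x : S2) : ℝ :=
  fderiv ℝ (fun y : E3 => F (radial y)) (x : E3) (EuclideanSpace.single i 1)

/-- The round metric `h_{ij}`, which is also the projection onto the tangent plane at `x`. -/
def met (x : S2) (i j : Fin 3) : ℝ := (if i = j then 1 else 0) - (x : E3) i * (x : E3) j

/-- The volume form `ε_{ij}` of the round metric, `ε(v, w) = det (x, v, w)`. -/
def eps (x : S2) (i j : Fin 3) : ℝ :=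
  (Matrix.of ![fun k => (x : E3) k, Pi.single i 1, Pi.single j 1]).det

/-- The differential `F_{||i}` of a function. -/
def grad (F : S2 → ℝ) (x : S2) (i : Fin 3) : ℝ := pd F i x

/-- The Levi-Civita covariant derivative `v_{i||j}` of a one-form: the tangential projection of the
tangential derivative. -/
def cov1 (v : S2 → Fin 3 → ℝ) (x : S2) (i j : Fin 3) : ℝ :=
  ∑ a, met x i a * pd (fun y => v y a) j x

/-- The Levi-Civita covariant derivative `T_{ij||k}` of a tensor field of rank two. -/
def cov2 (T : S2 → Fin 3 → Fin 3 → ℝ) (x : S2) (i j k : Fin 3) : ℝ :=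
  ∑ a, ∑ b, met x i a * met x j b * pd (fun y => T y a b) k x

/-- The second covariant derivative `F_{||ij}` of a function. -/
def hess (F : S2 → ℝ) : S2 → Fin 3 → Fin 3 → ℝ := cov1 (grad F)

/-- The Laplacian `D² F`. -/
def lap (F : S2 → ℝ) (x : S2) : ℝ := ∑ i, hess F x i i

/-- The operator `D² (D² + 2)`. -/
def lapLap (F : S2 → ℝ) : S2 → ℝ := lap (fun x => lap F x + 2 * F x)

/-- The divergence `T_{ij}^{||j}` of a tensor field of rank two. -/
def div2 (T : S2 → Fin 3 → Fin 3 → ℝ) (x : S2) (i : Fin 3) : ℝ := ∑ j, cov2 T x i j j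

/-- The double divergence `T_{ij}^{||ji}`. -/
def divdiv (T : S2 → Fin 3 → Fin 3 → ℝ) (x : S2) : ℝ := ∑ i, cov1 (div2 T) x i i

/-- Integration over the sphere with respect to the standard area measure (of total mass `4π`). -/
def sint (F : S2 → ℝ) : ℝ := ∫ x, F x ∂(volume : Measure E3).toSphere

/-- Linear combinations of the spherical harmonics with `l = 1`: restrictions of linear functions. -/
def IsDipole (n : S2 → ℝ) : Prop := ∃ a : E3, ∀ x : S2, n x = inner ℝ a (x : E3)

/-- `F` has no `l = 1` part. -/
def NoDipolePart (F : S2 → ℝ) : Prop := ∀ n, IsDipole n → sint (fun x => F x * n x) = 0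

/-- `F` has no `l = 0` part. -/
def NoMonopolePart (F : S2 → ℝ) : Prop := sint F = 0

/-!
### Data on null infinity
-/

/-- The data on null infinity: shear tensor `χ_{AB}`, mass aspect `m` and angular aspect `N_A`, as
functions of the retarded time and of the point of the sphere. -/
structure ScriData where
  χ : ℝ → S2 → Fin 3 → Fin 3 → ℝ
  m : ℝ → S2 → ℝ
  N : ℝ → S2 → Fin 3 → ℝ

/-- The data are smooth for retarded times in `I`, and there `χ` is a symmetric traceless tensor
field and `N` a one-form on the sphere. -/
structure ScriData.IsRegularOn (D : ScriData) (I : Set ℝ) : Prop where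
  smooth_χ : ∀ i j, ContMDiffOn (𝓘(ℝ, ℝ).prod (𝓡 2)) 𝓘(ℝ, ℝ) ∞
    (fun p : ℝ × S2 => D.χ p.1 p.2 i j) (I ×ˢ univ)
  smooth_m : ContMDiffOn (𝓘(ℝ, ℝ).prod (𝓡 2)) 𝓘(ℝ, ℝ) ∞
    (fun p : ℝ × S2 => D.m p.1 p.2) (I ×ˢ univ)
  smooth_N : ∀ i, ContMDiffOn (𝓘(ℝ, ℝ).prod (𝓡 2)) 𝓘(ℝ, ℝ) ∞
    (fun p : ℝ × S2 => D.N p.1 p.2 i) (I ×ˢ univ)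
  symm_χ : ∀ u ∈ I, ∀ x i j, D.χ u x i j = D.χ u x j i
  trace_χ : ∀ u ∈ I, ∀ x, ∑ i, D.χ u x i i = 0
  tangent_χ : ∀ u ∈ I, ∀ x i, ∑ j, D.χ u x i j * (x : E3) j = 0
  tangent_N : ∀ u ∈ I, ∀ x, ∑ i, D.N u x i * (x : E3) i = 0

/-- The derivative `χ̇` of the shear tensor in retarded time. -/
def ScriData.χdot (D : ScriData) (u : ℝ) (x : S2) (i j : Fin 3) : ℝ :=
  deriv (fun s => D.χ s x i j) u

/-- The second derivative `χ̈` of the shear tensor in retarded time. -/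
def ScriData.χddot (D : ScriData) (u : ℝ) (x : S2) (i j : Fin 3) : ℝ :=
  deriv (fun s => D.χdot s x i j) u

/-- The data after the supertranslation `u ↦ u - f`.  The new data are given as functions on the same
points of null infinity, which are labelled by their original coordinates `(u, x)`. -/
def ScriData.supertranslate (D : ScriData) (f : S2 → ℝ) : ScriData where
  χ u x i j := D.χ u x i j - 2 * hess f x i j + met x i j * lap f x
  m u x := D.m u x
    + 1 / 2 * ∑ i, div2 (D.χdot u) x i * grad f x i
    + 1 / 4 * ∑ i, ∑ j, D.χdot u x i j * hess f x i j
    + 1 / 4 * ∑ i, ∑ j, D.χddot u x i j * grad f x i * grad f x j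
  N u x i := D.N u x i - D.m u x * grad f x i
    + 1 / 4 * ∑ k, grad f x k * cov1 (div2 (D.χ u)) x i k
    - 1 / 4 * ∑ k, grad f x k * cov1 (div2 (D.χ u)) x k i
    + 1 / 4 * div2 (D.χdot u) x i * ∑ k, grad f x k * grad f x k
    - 1 / 4 * ∑ j, ∑ k, D.χdot u x j k * D.χ u x i j * grad f x k
    - 1 / 6 * (∑ j, ∑ k, D.χddot u x j k * grad f x j * grad f x k) * grad f x i
    - 1 / 2 * (∑ j, div2 (D.χdot u) x j * grad f x j) * grad f x i
    + 1 / 12 * (∑ j, D.χddot u x i j * grad f x j) * ∑ k, grad f x k * grad f x k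

/-!
### Potentials and angular momentum
-/

/-- `c` and `b` are the potentials of the tensor field `T`: smooth functions without `l = 0, 1` parts
such that `T_{AB} = 2 c_{||AB} - h_{AB} D² c + ε_{AC} b^{||C}_{||B} + ε_{BC} b^{||C}_{||A}`. -/
structure ArePotentials (T : S2 → Fin 3 → Fin 3 → ℝ) (c b : S2 → ℝ) : Prop where
  smooth_c : Smooth c
  smooth_b : Smooth b
  noMonopole_c : NoMonopolePart c
  noDipole_c : NoDipolePart c
  noMonopole_b : NoMonopolePart b
  noDipole_b : NoDipolePart b
  eq : ∀ x i j, T x i j = 2 * hess c x i j - met x i j * lap c x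
    + ∑ k, eps x i k * hess b x k j + ∑ k, eps x j k * hess b x k i

/-- `c` is a smooth solution of `D² (D² + 2) c = T_{AB}^{||BA}` without `l = 0, 1` parts. -/
structure IsElectricPotential (T : S2 → Fin 3 → Fin 3 → ℝ) (c : S2 → ℝ) : Prop where
  smooth : Smooth c
  noMonopole : NoMonopolePart c
  noDipole : NoDipolePart c
  eq : ∀ x, lapLap c x = divdiv T x

open Classical in
/-- The (unique) solution `c` of `D² (D² + 2) c = T_{AB}^{||BA}` without `l = 0, 1` parts. -/
def electricPotential (T : S2 → Fin 3 → Fin 3 → ℝ) : S2 → ℝ :=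
  if hc : ∃ c, IsElectricPotential T c then hc.choose else 0

/-- The angular momentum `J^(CJK)`, as a functional of the data on the sphere. -/
def angMomCJK (χ : S2 → Fin 3 → Fin 3 → ℝ) (N : S2 → Fin 3 → ℝ) (n : S2 → ℝ) : ℝ :=
  -(1 / (8 * Real.pi)) * sint (fun x => ∑ i, ∑ k,
    (3 * N x i + 1 / 4 * ∑ j, χ x i j * div2 χ x j) * eps x i k * grad n x k)

/-- The proposed angular momentum, formed with a given function `c`:
`J^(CJK) + 3 / (8π) ∫ m ε^{AD} n_{||D} c_{||A}`. -/
def angMomWith (χ : S2 → Fin 3 → Fin 3 → ℝ) (m : S2 → ℝ) (N : S2 → Fin 3 → ℝ) (n c : S2 → ℝ) : ℝ :=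
  angMomCJK χ N n
    + 3 / (8 * Real.pi) * sint (fun x => m x * ∑ i, ∑ k, eps x i k * grad n x k * grad c x i)

/-- The proposed angular momentum `J` of the data at retarded time `u`, for the dipole function `n`. -/
def ScriData.angMom (D : ScriData) (n : S2 → ℝ) (u : ℝ) : ℝ :=
  angMomWith (D.χ u) (D.m u) (D.N u) n (electricPotential (D.χ u))

end NullInfinity

end

/-!
In Cartesian components all of the calculus on the sphere that is needed is formal: it follows from
a few identities between the coordinates `X i`, the tangential derivatives `d i` and the integral.
The only analytic one, the divergence theorem, comes from integrating over `ℝ³` a derivative of a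
radially cut-off extension.

When the news vanishes, a supertranslation leaves `m` unchanged and turns `χ` into `χ - shear f`,
so `c` becomes `c - f` up to a constant, while `N` receives `-m grad f` and a curl. The electric
part of `χ` contributes nothing to this curl, and the magnetic part contributes `ε D²(D²+2)b`. The
change of the `m`-term cancels the contribution of `-m grad f`. The rotation field `Y = ε grad n` is
Killing; integrating by parts against it kills the terms quadratic in `f` and those in `c`.
Symmetric traceless tensors anticommute with `ε`, which reduces the terms in `b` to multiples of
`∫ n f D²(D²+2)b`, which cancel, and of `∫ f n_{||A} D^A D²(D²+2)b = 0`.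

The function `c - f` is a potential without `l = 1` part exactly when `f` has none. Potentials are
unique because `∫ |shear F|² = 2 ∫ F D²(D²+2)F`: the kernel of `D²(D²+2)` is that of the shear
operator, namely the functions with `l = 0, 1` parts only.
-/

noncomputable section

namespace NullInfinity

open Matrix

section CrossMatrix

variable {A : Type*} [CommRing A]

/-- The matrix `(i, j) ↦ det (v, e_i, e_j)`, that is `w ↦ w × v`. On the unit sphere, at the
position vector `v`, it is the volume form. -/
def crossMatrix (v : Fin 3 → A) : Matrix (Fin 3) (Fin 3) A :=
  .of fun i j => (Matrix.of ![v, Pi.single i 1, Pi.single j 1]).det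

theorem crossMatrix_eq (v : Fin 3 → A) :
    crossMatrix v = !![0, v 2, -v 1; -v 2, 0, v 0; v 1, -v 0, 0] := by
  ext i j
  fin_cases i <;> fin_cases j <;> simp [crossMatrix, det_fin_three]

theorem transpose_crossMatrix (v : Fin 3 → A) : (crossMatrix v)ᵀ = -crossMatrix v := by
  ext i j
  fin_cases i <;> fin_cases j <;> simp [crossMatrix_eq]

theorem crossMatrix_mulVec_self (v : Fin 3 → A) : crossMatrix v *ᵥ v = 0 := by
  ext i
  fin_cases i <;> simp [crossMatrix_eq, mulVec, dotProduct, Fin.sum_univ_three] <;> ring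

theorem crossMatrix_mul_self (v : Fin 3 → A) :
    crossMatrix v * crossMatrix v = vecMulVec v v - (v ⬝ᵥ v) • 1 := by
  ext i j
  fin_cases i <;> fin_cases j <;>
    simp [crossMatrix_eq, mul_apply, dotProduct, vecMulVec_apply, Fin.sum_univ_three] <;> ring

theorem transpose_mul_crossMatrix_add (M : Matrix (Fin 3) (Fin 3) A) (v : Fin 3 → A) :
    Mᵀ * crossMatrix v + crossMatrix v * M = crossMatrix (M.trace • v - M *ᵥ v) := by
  ext i j
  simp only [Matrix.add_apply, mul_apply, transpose_apply, Fin.sum_univ_three]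
  fin_cases i <;> fin_cases j <;>
    simp [crossMatrix_eq, mulVec, dotProduct, trace, Fin.sum_univ_three] <;> ring

theorem smul_crossMatrix_sub (v w : Fin 3 → A) :
    (v ⬝ᵥ v) • crossMatrix w - (v ⬝ᵥ w) • crossMatrix v =
      vecMulVec v (crossMatrix v *ᵥ w) - vecMulVec (crossMatrix v *ᵥ w) v := by
  ext i j
  simp only [Matrix.sub_apply, Matrix.smul_apply, vecMulVec_apply, mulVec, dotProduct,
    Fin.sum_univ_three]
  fin_cases i <;> fin_cases j <;> simp [crossMatrix_eq] <;> ring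

theorem trace_mul_crossMatrix {M : Matrix (Fin 3) (Fin 3) A} (hM : M.IsSymm) (v : Fin 3 → A) :
    trace (M * crossMatrix v) = 0 := by
  simp only [crossMatrix_eq, mul_apply, trace, diag_apply, Fin.sum_univ_three, of_apply, cons_val',
    cons_val_zero, cons_val_one, cons_val, cons_val_fin_one, hM.apply 0 1, hM.apply 0 2,
    hM.apply 1 2]
  ring

end CrossMatrix

/-- The algebraic rules of calculus on the unit sphere in Cartesian components: `X i` are the
coordinate functions, `d i` the components of the tangential gradient, and `I` is the integral. -/
structure SphereCalculus (A : Type*) [CommRing A] [Algebra ℝ A] where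
  X : Fin 3 → A
  d : Fin 3 → Derivation ℝ A A
  I : A →ₗ[ℝ] ℝ
  X_dotProduct_X : X ⬝ᵥ X = 1
  d_X : ∀ i j, d j (X i) = (1 : Matrix (Fin 3) (Fin 3) A) i j - X i * X j
  X_dotProduct_d : ∀ F, X ⬝ᵥ (fun i => d i F) = 0
  d_d_sub : ∀ i j F, d j (d i F) - d i (d j F) = X j * d i F - X i * d j F
  I_d : ∀ i F, I (d i F) = 2 * I (X i * F)

namespace SphereCalculus

variable {A : Type*} [CommRing A] [Algebra ℝ A] (S : SphereCalculus A)

/-- The round metric, equal to the projection onto the tangent planes. -/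
def met : Matrix (Fin 3) (Fin 3) A := 1 - vecMulVec S.X S.X

/-- The volume form. -/
def eps : Matrix (Fin 3) (Fin 3) A := crossMatrix S.X

/-- The gradient, as a tangential vector field in Cartesian components. -/
def grad : A →ₗ[ℝ] Fin 3 → A := LinearMap.pi fun i => (S.d i).toLinearMap

/-- The matrix `d j (v i)` of componentwise derivatives of a vector field. -/
def jac : (Fin 3 → A) →ₗ[ℝ] Matrix (Fin 3) (Fin 3) A where
  toFun v := .of fun i j => S.d j (v i)
  map_add' v w := by ext; simp
  map_smul' a v := by ext; simp

/-- The Levi-Civita derivative `v_{i||j}` of a tangential vector field. -/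
def cov1 : (Fin 3 → A) →ₗ[ℝ] Matrix (Fin 3) (Fin 3) A := LinearMap.mulLeft ℝ S.met ∘ₗ S.jac

/-- The covariant Hessian of a function. -/
def hess : A →ₗ[ℝ] Matrix (Fin 3) (Fin 3) A := S.cov1 ∘ₗ S.grad

/-- The Laplacian `D²`. -/
def lap : A →ₗ[ℝ] A := traceLinearMap (Fin 3) ℝ A ∘ₗ S.hess

/-- The operator `D² + 2`. -/
def lapTwo : A →ₗ[ℝ] A := S.lap + (2 : ℝ) • LinearMap.id

/-- The operator `D² (D² + 2)`. -/
def lapLap : A →ₗ[ℝ] A := S.lap ∘ₗ S.lapTwo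

/-- The componentwise divergence `∑ j, d j (T i j)` of the rows of a matrix field. -/
def rowDiv : Matrix (Fin 3) (Fin 3) A →ₗ[ℝ] Fin 3 → A where
  toFun T i := ∑ j, S.d j (T i j)
  map_add' T U := by ext; simp [Finset.sum_add_distrib]
  map_smul' a T := by ext; simp [Finset.smul_sum]

/-- The covariant divergence `T_{ij}^{||j}` of a tangential tensor field. -/
def div2 : Matrix (Fin 3) (Fin 3) A →ₗ[ℝ] Fin 3 → A :=
  (mulVecLin S.met).restrictScalars ℝ ∘ₗ S.rowDiv

/-- The double divergence `T_{ij}^{||ji}` of a tangential tensor field. -/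
def divdiv : Matrix (Fin 3) (Fin 3) A →ₗ[ℝ] A :=
  traceLinearMap (Fin 3) ℝ A ∘ₗ S.cov1 ∘ₗ S.div2

/-- The electric shear tensor with potential `F`. -/
def shear (F : A) : Matrix (Fin 3) (Fin 3) A := (2 : ℝ) • S.hess F - S.lap F • S.met

/-- The magnetic shear tensor with potential `F`. -/
def dualShear (F : A) : Matrix (Fin 3) (Fin 3) A := S.eps * S.hess F + (S.eps * S.hess F)ᵀ

/-- Symmetric traceless tangential tensor fields, the type of field to which the shear belongs. -/
structure IsShearType (T : Matrix (Fin 3) (Fin 3) A) : Prop where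
  isSymm : T.IsSymm
  mulVec_X : T *ᵥ S.X = 0
  trace_eq_zero : T.trace = 0

/-- Spherical harmonics with `l = 1`, characterized by the equation `n_{||ij} = -n h_{ij}`. -/
def IsFirstHarmonic (n : A) : Prop := S.hess n = -(n • S.met)

/-- The rotation generator `ε^{AB} n_{||B}` with Hamiltonian `n`; it is a Killing field when `n` is
a first harmonic. -/
def rotationField (n : A) : Fin 3 → A := S.eps *ᵥ S.grad n

/-- The angular momentum about the axis of `n`, formed with a given function `c` in place of the
electric potential of `χ`. -/
def angMom (χ : Matrix (Fin 3) (Fin 3) A) (m : A) (N : Fin 3 → A) (n c : A) : ℝ :=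
  -(1 / (8 * Real.pi)) *
      S.I (S.rotationField n ⬝ᵥ ((3 : ℝ) • N + (1 / 4 : ℝ) • χ *ᵥ S.div2 χ))
    + 3 / (8 * Real.pi) * S.I (m * (S.rotationField n ⬝ᵥ S.grad c))

section Metric

theorem grad_apply (F : A) (i : Fin 3) : S.grad F i = S.d i F := rfl

theorem jac_apply (v : Fin 3 → A) (i j : Fin 3) : S.jac v i j = S.d j (v i) := rfl

theorem cov1_apply (v : Fin 3 → A) : S.cov1 v = S.met * S.jac v := rfl

theorem div2_apply (T : Matrix (Fin 3) (Fin 3) A) : S.div2 T = S.met *ᵥ S.rowDiv T := rfl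

theorem lap_apply (F : A) : S.lap F = trace (S.hess F) := rfl

theorem lapTwo_apply (F : A) : S.lapTwo F = S.lap F + 2 * F := by
  simp [lapTwo, two_smul, two_mul]

theorem isSymm_met : S.met.IsSymm := by
  simp [IsSymm, met, transpose_sub]

theorem met_mulVec (v : Fin 3 → A) : S.met *ᵥ v = v - (S.X ⬝ᵥ v) • S.X := by
  simp [met, sub_mulVec, vecMulVec_mulVec]

theorem vecMul_met (v : Fin 3 → A) : v ᵥ* S.met = v - (S.X ⬝ᵥ v) • S.X := by
  rw [← mulVec_transpose, S.isSymm_met.eq, met_mulVec]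

theorem met_mulVec_X : S.met *ᵥ S.X = 0 := by
  rw [met_mulVec, X_dotProduct_X, one_smul, sub_self]

theorem trace_met : trace S.met = 2 := by
  rw [met, trace_sub, trace_one, trace_vecMulVec, X_dotProduct_X]
  norm_num

theorem X_dotProduct_grad (F : A) : S.X ⬝ᵥ S.grad F = 0 := S.X_dotProduct_d F

theorem jac_X : S.jac S.X = S.met := by
  ext i j
  exact S.d_X i j

theorem jac_mulVec_X (v : Fin 3 → A) : S.jac v *ᵥ S.X = 0 := by
  ext i
  rw [mulVec, dotProduct_comm]
  exact S.X_dotProduct_d (v i)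

variable {S}

theorem met_mulVec_of_tangent {v : Fin 3 → A} (hv : S.X ⬝ᵥ v = 0) : S.met *ᵥ v = v := by
  simp [met_mulVec, hv]

theorem vecMul_met_of_tangent {v : Fin 3 → A} (hv : S.X ⬝ᵥ v = 0) : v ᵥ* S.met = v := by
  simp [vecMul_met, hv]

theorem mul_met_of_mulVec_X {T : Matrix (Fin 3) (Fin 3) A} (hT : T *ᵥ S.X = 0) :
    T * S.met = T := by
  simp [met, mul_sub, mul_vecMulVec, hT]

theorem X_dotProduct_mulVec {T : Matrix (Fin 3) (Fin 3) A} (hT : T.IsSymm) (hX : T *ᵥ S.X = 0)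
    (v : Fin 3 → A) : S.X ⬝ᵥ T *ᵥ v = 0 := by
  rw [dotProduct_mulVec, ← mulVec_transpose, hT.eq, hX, zero_dotProduct]

end Metric

section CovariantDerivative

theorem grad_mul (F G : A) : S.grad (F * G) = F • S.grad G + G • S.grad F := by
  ext i
  simp [grad_apply]

theorem grad_dotProduct (v w : Fin 3 → A) :
    S.grad (v ⬝ᵥ w) = v ᵥ* S.jac w + w ᵥ* S.jac v := by
  ext i
  simp [grad_apply, jac_apply, dotProduct, vecMul, Finset.sum_add_distrib]

theorem jac_smul (F : A) (v : Fin 3 → A) :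
    S.jac (F • v) = F • S.jac v + vecMulVec v (S.grad F) := by
  ext i j
  simp [grad_apply, jac_apply, vecMulVec_apply]

theorem trace_jac (v : Fin 3 → A) : trace (S.jac v) = ∑ i, S.d i (v i) := rfl

variable {S}

theorem X_vecMul_jac {v : Fin 3 → A} (hv : S.X ⬝ᵥ v = 0) : S.X ᵥ* S.jac v = -v := by
  have h := S.grad_dotProduct S.X v
  rw [hv, map_zero, jac_X, vecMul_met_of_tangent hv] at h
  exact eq_neg_of_add_eq_zero_left h.symm

theorem cov1_eq_jac_add {v : Fin 3 → A} (hv : S.X ⬝ᵥ v = 0) :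
    S.cov1 v = S.jac v + vecMulVec S.X v := by
  rw [cov1_apply, met, sub_mul, one_mul, vecMulVec_mul, X_vecMul_jac hv, vecMulVec_neg,
    sub_neg_eq_add]

theorem trace_cov1 {v : Fin 3 → A} (hv : S.X ⬝ᵥ v = 0) : trace (S.cov1 v) = trace (S.jac v) := by
  rw [cov1_eq_jac_add hv, trace_add, trace_vecMulVec, hv, add_zero]

theorem cov1_smul {v : Fin 3 → A} (hv : S.X ⬝ᵥ v = 0) (F : A) :
    S.cov1 (F • v) = F • S.cov1 v + vecMulVec v (S.grad F) := by
  rw [cov1_apply, jac_smul, mul_add, mul_vecMulVec, met_mulVec_of_tangent hv, mul_smul_comm,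
    cov1_apply]

theorem grad_dotProduct_of_tangent {v w : Fin 3 → A} (hv : S.X ⬝ᵥ v = 0) (hw : S.X ⬝ᵥ w = 0) :
    S.grad (v ⬝ᵥ w) = v ᵥ* S.cov1 w + w ᵥ* S.cov1 v := by
  rw [grad_dotProduct, cov1_apply, cov1_apply, ← vecMul_vecMul, ← vecMul_vecMul,
    vecMul_met_of_tangent hv, vecMul_met_of_tangent hw]

theorem trace_cov1_mulVec {T : Matrix (Fin 3) (Fin 3) A} (hT : T.IsSymm) (hX : T *ᵥ S.X = 0)
    {v : Fin 3 → A} (hv : S.X ⬝ᵥ v = 0) :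
    trace (S.cov1 (T *ᵥ v)) = v ⬝ᵥ S.div2 T + trace (T * S.cov1 v) := by
  have leibniz : trace (S.jac (T *ᵥ v)) = v ⬝ᵥ S.rowDiv Tᵀ + trace (T * S.jac v) := by
    simp only [mulVec, dotProduct, map_sum, Derivation.leibniz, smul_eq_mul, rowDiv,
      LinearMap.coe_mk, AddHom.coe_mk, transpose_apply, trace, diag_apply, mul_apply, jac_apply,
      Finset.sum_add_distrib, Finset.mul_sum]
    rw [add_comm, Finset.sum_comm]
  rw [trace_cov1 (X_dotProduct_mulVec hT hX v), leibniz, hT.eq, cov1_apply, ← mul_assoc,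
    mul_met_of_mulVec_X hX, div2_apply, dotProduct_mulVec, vecMul_met_of_tangent hv]

variable (S)

theorem cov1_mulVec_X (v : Fin 3 → A) : S.cov1 v *ᵥ S.X = 0 := by
  rw [cov1_apply, ← mulVec_mulVec, jac_mulVec_X, mulVec_zero]

theorem isSymm_hess (F : A) : (S.hess F).IsSymm := by
  ext i j
  change S.cov1 (S.grad F) j i = S.cov1 (S.grad F) i j
  simp only [cov1_eq_jac_add (S.X_dotProduct_grad F), Matrix.add_apply, jac_apply, grad_apply,
    vecMulVec_apply]
  linear_combination S.d_d_sub j i F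

theorem hess_mulVec_X (F : A) : S.hess F *ᵥ S.X = 0 := S.cov1_mulVec_X _

theorem trace_cov1_smul_grad (F G : A) :
    trace (S.cov1 (F • S.grad G)) = F * S.lap G + S.grad F ⬝ᵥ S.grad G := by
  rw [cov1_smul (S.X_dotProduct_grad G), trace_add, trace_smul, trace_vecMulVec, smul_eq_mul,
    dotProduct_comm]
  rfl

end CovariantDerivative

section VolumeForm

theorem transpose_eps : S.epsᵀ = -S.eps := transpose_crossMatrix _

theorem eps_mulVec_X : S.eps *ᵥ S.X = 0 := crossMatrix_mulVec_self _

theorem eps_mul_eps : S.eps * S.eps = -S.met := by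
  rw [eps, crossMatrix_mul_self, X_dotProduct_X, one_smul, met, neg_sub]

theorem eps_mul_met : S.eps * S.met = S.eps := mul_met_of_mulVec_X S.eps_mulVec_X

theorem met_mul_eps : S.met * S.eps = S.eps := by
  simpa [transpose_mul, transpose_eps, S.isSymm_met.eq] using
    congrArg Matrix.transpose S.eps_mul_met

theorem X_dotProduct_eps_mulVec (v : Fin 3 → A) : S.X ⬝ᵥ S.eps *ᵥ v = 0 := by
  rw [dotProduct_mulVec, ← mulVec_transpose, transpose_eps, neg_mulVec, eps_mulVec_X, neg_zero,
    zero_dotProduct]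

theorem rowDiv_eps : S.rowDiv S.eps = 0 := by
  ext i
  simp only [rowDiv, LinearMap.coe_mk, AddHom.coe_mk, Fin.sum_univ_three]
  fin_cases i <;> simp [eps, crossMatrix_eq, d_X] <;> ring

variable {S}

theorem eps_mulVec_dotProduct_eps_mulVec {v w : Fin 3 → A} (hv : S.X ⬝ᵥ v = 0) :
    (S.eps *ᵥ v) ⬝ᵥ (S.eps *ᵥ w) = v ⬝ᵥ w := by
  rw [dotProduct_mulVec, ← vecMul_transpose, vecMul_vecMul, transpose_eps, neg_mul, eps_mul_eps,
    neg_neg, vecMul_met_of_tangent hv]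

theorem eps_mul_add_mul_eps {T : Matrix (Fin 3) (Fin 3) A} (hT : T.IsSymm)
    (hX : T *ᵥ S.X = 0) : T * S.eps + S.eps * T = T.trace • S.eps := by
  have h := transpose_mul_crossMatrix_add T S.X
  rw [hT.eq, hX, sub_zero] at h
  rw [eps, h]
  ext i j
  fin_cases i <;> fin_cases j <;> simp [crossMatrix_eq]

theorem jac_eps_mulVec {v : Fin 3 → A} (hv : S.X ⬝ᵥ v = 0) :
    S.jac (S.eps *ᵥ v) = S.eps * S.jac v - vecMulVec S.X (S.eps *ᵥ v) := by
  have leibniz : S.jac (S.eps *ᵥ v) =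
      S.eps * S.jac v - crossMatrix v - vecMulVec (S.eps *ᵥ v) S.X := by
    ext i j
    simp only [jac_apply, Matrix.sub_apply, mul_apply, mulVec, dotProduct, vecMulVec_apply,
      Fin.sum_univ_three]
    fin_cases i <;> fin_cases j <;> simp [eps, crossMatrix_eq, d_X] <;> ring
  have h := smul_crossMatrix_sub S.X v
  rw [X_dotProduct_X, hv, one_smul, zero_smul, sub_zero] at h
  rw [leibniz, h, eps]
  abel

theorem cov1_eps_mulVec {v : Fin 3 → A} (hv : S.X ⬝ᵥ v = 0) :
    S.cov1 (S.eps *ᵥ v) = S.eps * S.cov1 v := by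
  rw [cov1_eq_jac_add (S.X_dotProduct_eps_mulVec v), jac_eps_mulVec hv, sub_add_cancel,
    cov1_apply, ← mul_assoc, eps_mul_met]

end VolumeForm

section Divergence

theorem rowDiv_vecMulVec_X (v : Fin 3 → A) : S.rowDiv (vecMulVec v S.X) = (2 : A) • v := by
  ext i
  have h : S.rowDiv (vecMulVec v S.X) i = v i * trace S.met + S.X ⬝ᵥ S.grad (v i) := by
    simp only [rowDiv, LinearMap.coe_mk, AddHom.coe_mk, vecMulVec_apply, Derivation.leibniz,
      smul_eq_mul, Finset.sum_add_distrib, ← Finset.mul_sum]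
    rw [← S.jac_X]
    rfl
  rw [h, S.trace_met, S.X_dotProduct_grad, add_zero, mul_comm]
  rfl

theorem rowDiv_smul (F : A) (T : Matrix (Fin 3) (Fin 3) A) :
    S.rowDiv (F • T) = F • S.rowDiv T + T *ᵥ S.grad F := by
  ext i
  simp [rowDiv, mulVec, dotProduct, grad_apply, Finset.sum_add_distrib, Finset.mul_sum]

theorem div2_smul_met (F : A) : S.div2 (F • S.met) = S.grad F := by
  have rowDiv_one : S.rowDiv 1 = 0 := by
    ext i
    change ∑ j, S.d j ((1 : Matrix (Fin 3) (Fin 3) A) i j) = 0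
    refine Finset.sum_eq_zero fun j _ => ?_
    by_cases hij : i = j <;> simp [one_apply, hij]
  have h : S.rowDiv (F • S.met) = S.grad F - (2 * F) • S.X := by
    rw [met, smul_sub, map_sub, rowDiv_smul, rowDiv_one, ← smul_vecMulVec, rowDiv_vecMulVec_X,
      one_mulVec, smul_zero, zero_add, smul_smul]
  rw [div2_apply, h, mulVec_sub, met_mulVec_of_tangent (S.X_dotProduct_grad F), mulVec_smul,
    met_mulVec_X, smul_zero, sub_zero]

theorem div2_smul_eps (F : A) : S.div2 (F • S.eps) = S.eps *ᵥ S.grad F := by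
  rw [div2_apply, rowDiv_smul, rowDiv_eps, smul_zero, zero_add, mulVec_mulVec, met_mul_eps]

variable {S}

-- The Ricci identity for `v_{j||i}^{||j}`; the last term is `R_{ij} v^j`, as `R_{ij} = h_{ij}`.
theorem div2_transpose_cov1 {v : Fin 3 → A} (hv : S.X ⬝ᵥ v = 0) :
    S.div2 (S.cov1 v)ᵀ = S.grad (trace (S.cov1 v)) + v := by
  have rowDiv_transpose_jac : S.rowDiv (S.jac v)ᵀ =
      S.grad (trace (S.jac v)) + S.X ᵥ* S.jac v - trace (S.jac v) • S.X := by
    ext i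
    have comm (j : Fin 3) : S.d j (S.d i (v j)) =
        S.d i (S.d j (v j)) + S.X j * S.d i (v j) - S.d j (v j) * S.X i := by
      linear_combination S.d_d_sub i j (v j)
    simp only [rowDiv, LinearMap.coe_mk, AddHom.coe_mk, transpose_apply, jac_apply, comm,
      grad_apply, trace, diag_apply, map_sum, vecMul, dotProduct, Pi.add_apply, Pi.sub_apply,
      Pi.smul_apply, smul_eq_mul, Finset.sum_add_distrib, Finset.sum_sub_distrib, Finset.sum_mul,
      Finset.sum_apply]
  rw [trace_cov1 hv, cov1_eq_jac_add hv, transpose_add, transpose_vecMulVec, div2_apply, map_add,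
    rowDiv_transpose_jac, rowDiv_vecMulVec_X, X_vecMul_jac hv]
  simp only [mulVec_add, mulVec_sub, mulVec_smul, mulVec_neg, met_mulVec_X,
    met_mulVec_of_tangent (S.X_dotProduct_grad _), met_mulVec_of_tangent hv]
  module

variable (S)

theorem div2_hess (F : A) : S.div2 (S.hess F) = S.grad (S.lap F + F) := by
  rw [← S.isSymm_hess F, map_add]
  exact div2_transpose_cov1 (S.X_dotProduct_grad F)

theorem div2_shear (F : A) : S.div2 (S.shear F) = S.grad (S.lapTwo F) := by
  rw [shear, map_sub, map_smul, div2_hess, div2_smul_met, lapTwo_apply, two_mul]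
  simp only [map_add]
  module

theorem trace_eps_mul_hess (F : A) : trace (S.eps * S.hess F) = 0 := by
  rw [trace_mul_comm]
  exact trace_mul_crossMatrix (S.isSymm_hess F) S.X

theorem eps_mul_hess_sub_transpose (F : A) :
    S.eps * S.hess F - (S.eps * S.hess F)ᵀ = S.lap F • S.eps := by
  rw [transpose_mul, (S.isSymm_hess F).eq, transpose_eps, mul_neg, sub_neg_eq_add, add_comm,
    eps_mul_add_mul_eps (S.isSymm_hess F) (S.hess_mulVec_X F), lap_apply]

theorem cov1_eps_mulVec_grad (F : A) : S.cov1 (S.eps *ᵥ S.grad F) = S.eps * S.hess F :=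
  cov1_eps_mulVec (S.X_dotProduct_grad F)

theorem div2_dualShear (F : A) : S.div2 (S.dualShear F) = S.eps *ᵥ S.grad (S.lapTwo F) := by
  have div2_transpose : S.div2 (S.eps * S.hess F)ᵀ = S.eps *ᵥ S.grad F := by
    rw [← cov1_eps_mulVec_grad, div2_transpose_cov1 (S.X_dotProduct_eps_mulVec _),
      cov1_eps_mulVec_grad, trace_eps_mul_hess, map_zero, zero_add]
  have split : S.dualShear F = S.lap F • S.eps + (2 : ℝ) • (S.eps * S.hess F)ᵀ := by
    rw [dualShear, ← eps_mul_hess_sub_transpose]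
    module
  rw [split, map_add, div2_smul_eps, map_smul, div2_transpose, lapTwo_apply, two_mul]
  simp only [map_add, mulVec_add, two_smul]

/-- The shear tensor with electric potential `c` and magnetic potential `b`. -/
def shearOfPotentials (c b : A) : Matrix (Fin 3) (Fin 3) A := S.shear c + S.dualShear b

theorem div2_shearOfPotentials (c b : A) : S.div2 (S.shearOfPotentials c b) =
    S.grad (S.lapTwo c) + S.eps *ᵥ S.grad (S.lapTwo b) := by
  rw [shearOfPotentials, map_add, div2_shear, div2_dualShear]

theorem divdiv_shearOfPotentials (c b : A) : S.divdiv (S.shearOfPotentials c b) = S.lapLap c := by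
  change trace (S.cov1 (S.div2 _)) = _
  rw [div2_shearOfPotentials, map_add, trace_add, cov1_eps_mulVec_grad, trace_eps_mul_hess,
    add_zero]
  rfl

theorem cov1_div2_shearOfPotentials_sub_transpose (c b : A) :
    S.cov1 (S.div2 (S.shearOfPotentials c b)) - (S.cov1 (S.div2 (S.shearOfPotentials c b)))ᵀ =
      S.lapLap b • S.eps := by
  have hess_symm : (S.cov1 (S.grad (S.lapTwo c)))ᵀ = S.cov1 (S.grad (S.lapTwo c)) :=
    S.isSymm_hess _
  rw [div2_shearOfPotentials, map_add, transpose_add, hess_symm, add_sub_add_left_eq_sub,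
    cov1_eps_mulVec_grad, eps_mul_hess_sub_transpose]
  rfl

theorem isShearType_shear (F : A) : S.IsShearType (S.shear F) where
  isSymm := ((S.isSymm_hess F).smul _).sub (S.isSymm_met.smul _)
  mulVec_X := by
    rw [shear, sub_mulVec, smul_mulVec, smul_mulVec, hess_mulVec_X, met_mulVec_X]
    simp
  trace_eq_zero := by
    rw [shear, trace_sub, trace_smul, trace_smul, trace_met, ← lap_apply, smul_eq_mul, two_smul]
    ring

theorem isShearType_dualShear (F : A) : S.IsShearType (S.dualShear F) where
  isSymm := isSymm_add_transpose_self _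
  mulVec_X := by
    rw [dualShear, transpose_mul, transpose_eps, add_mulVec, ← mulVec_mulVec, ← mulVec_mulVec,
      hess_mulVec_X, neg_mulVec, eps_mulVec_X]
    simp
  trace_eq_zero := by
    rw [dualShear, trace_add, trace_transpose, trace_eps_mul_hess, add_zero]

theorem isShearType_shearOfPotentials (c b : A) : S.IsShearType (S.shearOfPotentials c b) where
  isSymm := (S.isShearType_shear c).isSymm.add (S.isShearType_dualShear b).isSymm
  mulVec_X := by
    rw [shearOfPotentials, add_mulVec, (S.isShearType_shear c).mulVec_X,
      (S.isShearType_dualShear b).mulVec_X, add_zero]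
  trace_eq_zero := by
    rw [shearOfPotentials, trace_add, (S.isShearType_shear c).trace_eq_zero,
      (S.isShearType_dualShear b).trace_eq_zero, add_zero]

end Divergence

section Integration

variable {S}

theorem I_trace_cov1 {v : Fin 3 → A} (hv : S.X ⬝ᵥ v = 0) : S.I (trace (S.cov1 v)) = 0 := by
  rw [trace_cov1 hv, trace_jac, map_sum]
  simp only [I_d, ← Finset.mul_sum, ← map_sum]
  rw [← dotProduct, hv, map_zero, mul_zero]

theorem I_dotProduct_grad {v : Fin 3 → A} (hv : S.X ⬝ᵥ v = 0) (F : A) :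
    S.I (v ⬝ᵥ S.grad F) = -S.I (F * trace (S.cov1 v)) := by
  have h := I_trace_cov1 (S := S) (v := F • v) (by rw [dotProduct_smul, hv, smul_zero])
  rw [cov1_smul hv, trace_add, trace_smul, trace_vecMulVec, map_add] at h
  exact eq_neg_of_add_eq_zero_right h

theorem I_dotProduct_mulVec_grad {T : Matrix (Fin 3) (Fin 3) A} (hT : T.IsSymm)
    (hX : T *ᵥ S.X = 0) {v : Fin 3 → A} (hv : S.X ⬝ᵥ v = 0) (hTv : trace (T * S.cov1 v) = 0)
    (F : A) : S.I (v ⬝ᵥ T *ᵥ S.grad F) = -S.I (F * (v ⬝ᵥ S.div2 T)) := by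
  rw [dotProduct_mulVec, ← mulVec_transpose, hT.eq,
    I_dotProduct_grad (X_dotProduct_mulVec hT hX v), trace_cov1_mulVec hT hX hv, hTv, add_zero]

variable (S)

theorem I_grad_dotProduct_grad (F G : A) :
    S.I (S.grad F ⬝ᵥ S.grad G) = -S.I (G * S.lap F) :=
  I_dotProduct_grad (S.X_dotProduct_grad F) G

theorem I_mul_lapTwo_comm (F G : A) : S.I (F * S.lapTwo G) = S.I (G * S.lapTwo F) := by
  have h : S.I (F * S.lap G) = S.I (G * S.lap F) := by
    rw [← neg_inj, ← I_grad_dotProduct_grad, ← I_grad_dotProduct_grad, dotProduct_comm]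
  simp only [lapTwo_apply, mul_add, map_add, h]
  ring_nf

end Integration

section FirstHarmonic

variable {S} {n : A}

namespace IsFirstHarmonic

variable (hn : S.IsFirstHarmonic n)
include hn

theorem lap_eq : S.lap n = -2 * n := by
  rw [lap_apply, hn, trace_neg, trace_smul, trace_met, smul_eq_mul]
  ring

theorem trace_mul_hess {T : Matrix (Fin 3) (Fin 3) A} (hT : S.IsShearType T) :
    trace (T * S.cov1 (S.grad n)) = 0 := by
  change trace (T * S.hess n) = 0
  rw [hn, mul_neg, mul_smul_comm, mul_met_of_mulVec_X hT.mulVec_X, trace_neg, trace_smul,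
    hT.trace_eq_zero, smul_zero, neg_zero]

theorem cov1_rotationField : S.cov1 (S.rotationField n) = -(n • S.eps) := by
  rw [rotationField, cov1_eps_mulVec_grad, hn, mul_neg, mul_smul_comm, eps_mul_met]

theorem trace_mul_cov1_rotationField {T : Matrix (Fin 3) (Fin 3) A} (hT : T.IsSymm) :
    trace (T * S.cov1 (S.rotationField n)) = 0 := by
  rw [hn.cov1_rotationField, mul_neg, mul_smul_comm, trace_neg, trace_smul, eps,
    trace_mul_crossMatrix hT, smul_zero, neg_zero]

theorem lapTwo_grad_dotProduct_grad_sub (F : A) :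
    S.lapTwo (S.grad n ⬝ᵥ S.grad F - n * F) =
      S.grad n ⬝ᵥ S.grad (S.lap F) - 3 * (n * S.lap F) := by
  have hess_mul_hess : trace (S.hess F * S.cov1 (S.grad n)) = -(n * S.lap F) := by
    change trace (S.hess F * S.hess n) = _
    rw [hn, mul_neg, mul_smul_comm, mul_met_of_mulVec_X (S.hess_mulVec_X F), trace_neg,
      trace_smul, lap_apply, smul_eq_mul]
  have grad_eq : S.grad (S.grad n ⬝ᵥ S.grad F - n * F) =
      S.hess F *ᵥ S.grad n - (n • S.grad F + n • S.grad F) - F • S.grad n := by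
    have hess_F : S.grad n ᵥ* S.cov1 (S.grad F) = S.hess F *ᵥ S.grad n := by
      rw [← mulVec_transpose]
      exact congrArg (· *ᵥ S.grad n) (S.isSymm_hess F)
    have hess_n : S.grad F ᵥ* S.cov1 (S.grad n) = -(n • S.grad F) := by
      change S.grad F ᵥ* S.hess n = _
      rw [hn, vecMul_neg, vecMul_smul, vecMul_met_of_tangent (S.X_dotProduct_grad F)]
    rw [map_sub, grad_mul, grad_dotProduct_of_tangent (S.X_dotProduct_grad n)
      (S.X_dotProduct_grad F), hess_F, hess_n]
    module
  have lap_eq_trace (G : A) : S.lap G = trace (S.cov1 (S.grad G)) := rfl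
  rw [lapTwo_apply, lap_eq_trace, grad_eq, map_sub, map_sub, map_add, trace_sub, trace_sub,
    trace_add, trace_cov1_mulVec (S.isSymm_hess F) (S.hess_mulVec_X F) (S.X_dotProduct_grad n),
    trace_cov1_smul_grad, trace_cov1_smul_grad, hess_mul_hess, div2_hess, hn.lap_eq, map_add,
    dotProduct_add, dotProduct_comm (S.grad F)]
  ring

theorem I_mul_grad_dotProduct_grad (F G : A) :
    S.I (G * (S.grad n ⬝ᵥ S.grad F)) =
      2 * S.I (n * F * G) - S.I (F * (S.grad n ⬝ᵥ S.grad G)) := by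
  have h := I_dotProduct_grad (S := S) (v := G • S.grad n)
    (by rw [dotProduct_smul, X_dotProduct_grad, smul_zero]) F
  rw [trace_cov1_smul_grad, hn.lap_eq, smul_dotProduct, smul_eq_mul] at h
  rw [h, mul_add, map_add, dotProduct_comm (S.grad G), neg_add, ← sub_eq_add_neg,
    show F * (G * (-2 * n)) = -(n * F * G + n * F * G) by ring, map_neg, map_add]
  ring

end IsFirstHarmonic

end FirstHarmonic

section ShearKernel

theorem I_trace_shear_mul_self (F : A) :
    S.I (trace (S.shear F * S.shear F)) = 2 * S.I (F * S.lapLap F) := by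
  have hT := S.isShearType_shear F
  have trace_eq : trace (S.shear F * S.shear F) =
      (2 : ℝ) • trace (S.shear F * S.cov1 (S.grad F)) := by
    nth_rw 2 [shear]
    rw [mul_sub, mul_smul_comm, mul_smul_comm, mul_met_of_mulVec_X hT.mulVec_X, trace_sub,
      trace_smul, trace_smul, hT.trace_eq_zero, smul_zero, sub_zero]
    rfl
  have h := I_trace_cov1 (X_dotProduct_mulVec hT.isSymm hT.mulVec_X (S.grad F))
  rw [trace_cov1_mulVec hT.isSymm hT.mulVec_X (S.X_dotProduct_grad F), div2_shear, map_add,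
    dotProduct_comm, I_grad_dotProduct_grad, neg_add_eq_zero] at h
  rw [trace_eq, map_smul, ← h, smul_eq_mul]
  rfl

theorem jac_grad_add_smul_X (F : A) :
    S.jac (S.grad F + F • S.X) = S.hess F + F • S.met := by
  change _ = S.cov1 (S.grad F) + _
  rw [map_add, jac_smul, jac_X, cov1_eq_jac_add (S.X_dotProduct_grad F)]
  abel

theorem I_lap (F : A) : S.I (S.lap F) = 0 := I_trace_cov1 (S.X_dotProduct_grad F)

variable {S}

theorem isFirstHarmonic_iff_jac_eq_zero {F : A} :
    S.IsFirstHarmonic F ↔ S.jac (S.grad F + F • S.X) = 0 := by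
  rw [jac_grad_add_smul_X, IsFirstHarmonic, eq_neg_iff_add_eq_zero]

theorem IsFirstHarmonic.I_eq_zero {n : A} (hn : S.IsFirstHarmonic n) : S.I n = 0 := by
  have h := S.I_lap n
  rw [hn.lap_eq, neg_mul, two_mul, map_neg, map_add] at h
  linarith

theorem isFirstHarmonic_X_dotProduct {a : Fin 3 → A} (ha : S.jac a = 0) :
    S.IsFirstHarmonic (S.X ⬝ᵥ a) := by
  rw [isFirstHarmonic_iff_jac_eq_zero, grad_dotProduct, ha, vecMul_zero, zero_add, jac_X,
    vecMul_met, sub_add_cancel, ha]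

theorem grad_lapTwo_eq_zero_of_shear_eq_zero {F : A} (hF : S.shear F = 0) :
    S.grad (S.lapTwo F) = 0 := by
  rw [← div2_shear, hF, map_zero]

variable (S)

theorem hess_algebraMap (k : ℝ) : S.hess (algebraMap ℝ A k) = 0 := by
  have h : S.grad (algebraMap ℝ A k) = 0 := by
    ext i
    exact (S.d i).map_algebraMap k
  change S.cov1 (S.grad _) = 0
  rw [h, map_zero]

theorem lap_algebraMap (k : ℝ) : S.lap (algebraMap ℝ A k) = 0 := by
  rw [lap_apply, hess_algebraMap, trace_zero]

theorem shear_add_algebraMap (F : A) (k : ℝ) : S.shear (F + algebraMap ℝ A k) = S.shear F := by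
  rw [shear, map_add, map_add, hess_algebraMap, lap_algebraMap, add_zero, add_zero, shear]

theorem shear_sub (F G : A) : S.shear (F - G) = S.shear F - S.shear G := by
  simp only [shear, map_sub, smul_sub, sub_smul]
  abel

variable {S}

theorem isFirstHarmonic_sub_of_shear_eq_zero {F : A} (hF : S.shear F = 0) {k : ℝ}
    (hk : S.lapTwo F = algebraMap ℝ A k) :
    S.IsFirstHarmonic (F - algebraMap ℝ A (k / 2)) := by
  have hess_eq : (2 : ℝ) • S.hess F = S.lap F • S.met := sub_eq_zero.mp hF
  have lap_eq : S.lap F = (2 : ℝ) • (algebraMap ℝ A (k / 2) - F) := by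
    rw [lapTwo_apply] at hk
    rw [eq_sub_of_add_eq hk, smul_sub, Algebra.smul_def, ← map_mul, mul_div_cancel₀ _ two_ne_zero,
      two_smul, two_mul]
  have h : (2 : ℝ) • S.hess F = (2 : ℝ) • ((algebraMap ℝ A (k / 2) - F) • S.met) := by
    rw [hess_eq, lap_eq, smul_assoc]
  rw [IsFirstHarmonic, map_sub, hess_algebraMap, sub_zero, ← neg_smul, neg_sub]
  exact smul_right_injective _ (two_ne_zero' ℝ) h

end ShearKernel

section AngularMomentum

theorem I_mul_rotationField_dotProduct_grad (n F G : A) :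
    S.I (F * (S.rotationField n ⬝ᵥ S.grad G)) = -S.I (G * (S.rotationField n ⬝ᵥ S.grad F)) := by
  have h := I_dotProduct_grad (S.X_dotProduct_eps_mulVec (S.grad n)) (F * G)
  rw [cov1_eps_mulVec_grad, trace_eps_mul_hess, mul_zero, map_zero, neg_zero, grad_mul,
    dotProduct_add, dotProduct_smul, dotProduct_smul, map_add] at h
  exact eq_neg_of_add_eq_zero_left h

theorem I_mul_self_rotationField (n F : A) :
    S.I (F * (S.rotationField n ⬝ᵥ S.grad F)) = 0 :=
  self_eq_neg.mp (S.I_mul_rotationField_dotProduct_grad n F F)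

theorem rotationField_dotProduct_eps_mulVec_grad (n F : A) :
    S.rotationField n ⬝ᵥ S.eps *ᵥ S.grad F = S.grad n ⬝ᵥ S.grad F :=
  eps_mulVec_dotProduct_eps_mulVec (S.X_dotProduct_grad n)

variable {S}

theorem IsShearType.rotationField_dotProduct_mulVec_eps_mulVec_grad
    {T : Matrix (Fin 3) (Fin 3) A} (hT : S.IsShearType T) (n F : A) :
    S.rotationField n ⬝ᵥ T *ᵥ S.eps *ᵥ S.grad F = -(S.grad n ⬝ᵥ T *ᵥ S.grad F) := by
  have anticommute : T * S.eps = -(S.eps * T) := by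
    rw [eq_neg_iff_add_eq_zero, eps_mul_add_mul_eps hT.isSymm hT.mulVec_X, hT.trace_eq_zero,
      zero_smul]
  rw [mulVec_mulVec, anticommute, neg_mulVec, ← mulVec_mulVec, dotProduct_neg, rotationField,
    eps_mulVec_dotProduct_eps_mulVec (S.X_dotProduct_grad n)]

namespace IsFirstHarmonic

variable {n : A} (hn : S.IsFirstHarmonic n) (c b f : A)
include hn

theorem I_rotationField_dotProduct_mulVec_grad {T : Matrix (Fin 3) (Fin 3) A}
    (hT : S.IsShearType T) (F : A) :
    S.I (S.rotationField n ⬝ᵥ T *ᵥ S.grad F) = -S.I (F * (S.rotationField n ⬝ᵥ S.div2 T)) :=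
  I_dotProduct_mulVec_grad hT.isSymm hT.mulVec_X (S.X_dotProduct_eps_mulVec _)
    (hn.trace_mul_cov1_rotationField hT.isSymm) F

theorem I_rotationField_dotProduct_shear_mulVec_div2 :
    S.I (S.rotationField n ⬝ᵥ S.shear f *ᵥ S.div2 (S.shearOfPotentials c b)) =
      S.I (S.lapTwo b * (S.grad n ⬝ᵥ S.grad (S.lapTwo f)))
        - S.I (S.lapTwo c * (S.rotationField n ⬝ᵥ S.grad (S.lapTwo f))) := by
  have hT := S.isShearType_shear f
  have electric := hn.I_rotationField_dotProduct_mulVec_grad hT (S.lapTwo c)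
  have magnetic := I_dotProduct_mulVec_grad hT.isSymm hT.mulVec_X (S.X_dotProduct_grad n)
    (hn.trace_mul_hess hT) (S.lapTwo b)
  rw [div2_shear] at electric magnetic
  rw [div2_shearOfPotentials, mulVec_add, dotProduct_add, map_add, electric,
    hT.rotationField_dotProduct_mulVec_eps_mulVec_grad, map_neg, magnetic]
  ring

theorem I_rotationField_dotProduct_mulVec_div2_sub_shear :
    S.I (S.rotationField n ⬝ᵥ (S.shearOfPotentials c b - S.shear f) *ᵥ
        S.div2 (S.shearOfPotentials c b - S.shear f)) =
      S.I (S.rotationField n ⬝ᵥ S.shearOfPotentials c b *ᵥ S.div2 (S.shearOfPotentials c b))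
        + (S.I (S.lapTwo f * (S.grad n ⬝ᵥ S.grad (S.lapTwo b)))
          - S.I (S.lapTwo b * (S.grad n ⬝ᵥ S.grad (S.lapTwo f)))) := by
  have shear_grad :
      S.I (S.rotationField n ⬝ᵥ S.shear f *ᵥ S.grad (S.lapTwo f)) = 0 := by
    rw [hn.I_rotationField_dotProduct_mulVec_grad (S.isShearType_shear f), div2_shear,
      I_mul_self_rotationField, neg_zero]
  have shearOfPotentials_grad :
      S.I (S.rotationField n ⬝ᵥ S.shearOfPotentials c b *ᵥ S.grad (S.lapTwo f)) =
        S.I (S.lapTwo c * (S.rotationField n ⬝ᵥ S.grad (S.lapTwo f)))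
          - S.I (S.lapTwo f * (S.grad n ⬝ᵥ S.grad (S.lapTwo b))) := by
    rw [hn.I_rotationField_dotProduct_mulVec_grad (S.isShearType_shearOfPotentials c b),
      div2_shearOfPotentials, dotProduct_add, rotationField_dotProduct_eps_mulVec_grad, mul_add,
      map_add, I_mul_rotationField_dotProduct_grad]
    ring
  rw [map_sub, div2_shear, sub_mulVec, mulVec_sub, mulVec_sub, dotProduct_sub, dotProduct_sub,
    dotProduct_sub, map_sub, map_sub, map_sub, shear_grad, shearOfPotentials_grad,
    hn.I_rotationField_dotProduct_shear_mulVec_div2]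
  ring

theorem I_lapTwo_mul_grad_dotProduct_grad_lapTwo_sub :
    S.I (S.lapTwo f * (S.grad n ⬝ᵥ S.grad (S.lapTwo b)))
        - S.I (S.lapTwo b * (S.grad n ⬝ᵥ S.grad (S.lapTwo f))) =
      2 * (S.I (f * (S.grad n ⬝ᵥ S.grad (S.lapLap b))) - 3 * S.I (n * f * S.lapLap b)) := by
  have three_mul_I : 3 * S.I (n * f * S.lapLap b) = S.I (3 * (n * f * S.lapLap b)) := by
    rw [← smul_eq_mul, ← map_smul, Algebra.smul_def, map_ofNat]
  calc
    _ = 2 * S.I ((S.grad n ⬝ᵥ S.grad (S.lapTwo b) - n * S.lapTwo b) * S.lapTwo f) := by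
      rw [hn.I_mul_grad_dotProduct_grad (S.lapTwo f), sub_mul, map_sub,
        mul_comm (S.grad n ⬝ᵥ _) (S.lapTwo f), mul_right_comm n]
      ring
    _ = 2 * S.I (f * S.lapTwo (S.grad n ⬝ᵥ S.grad (S.lapTwo b) - n * S.lapTwo b)) := by
      rw [I_mul_lapTwo_comm]
    _ = _ := by
      rw [hn.lapTwo_grad_dotProduct_grad_sub, three_mul_I, ← map_sub]
      congr 2
      change f * (_ ⬝ᵥ S.grad (S.lapLap b) - 3 * (n * S.lapLap b)) = _
      ring

theorem I_rotationField_dotProduct_curl_mulVec_grad :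
    S.I (S.rotationField n ⬝ᵥ (S.cov1 (S.div2 (S.shearOfPotentials c b))
        - (S.cov1 (S.div2 (S.shearOfPotentials c b)))ᵀ) *ᵥ S.grad f) =
      2 * S.I (n * f * S.lapLap b) - S.I (f * (S.grad n ⬝ᵥ S.grad (S.lapLap b))) := by
  rw [cov1_div2_shearOfPotentials_sub_transpose, smul_mulVec, dotProduct_smul,
    rotationField_dotProduct_eps_mulVec_grad, smul_eq_mul, hn.I_mul_grad_dotProduct_grad]

theorem angMom_supertranslate
    (horth : S.I (f * (S.grad n ⬝ᵥ S.grad (S.lapLap b))) = 0) (m : A) (N : Fin 3 → A) :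
    S.angMom (S.shearOfPotentials c b - S.shear f) m
        (N - m • S.grad f + (1 / 4 : ℝ) • (S.cov1 (S.div2 (S.shearOfPotentials c b))
          - (S.cov1 (S.div2 (S.shearOfPotentials c b)))ᵀ) *ᵥ S.grad f) n (c - f) =
      S.angMom (S.shearOfPotentials c b) m N n c := by
  have quadratic := hn.I_rotationField_dotProduct_mulVec_div2_sub_shear c b f
  rw [hn.I_lapTwo_mul_grad_dotProduct_grad_lapTwo_sub, horth] at quadratic
  have curl := hn.I_rotationField_dotProduct_curl_mulVec_grad c b f
  rw [horth] at curl
  generalize S.shearOfPotentials c b - S.shear f = χ' at quadratic ⊢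
  simp only [angMom, dotProduct_add, dotProduct_sub, dotProduct_smul, map_add, map_sub, map_smul,
    smul_add, smul_sub, smul_eq_mul, mul_sub, quadratic, curl]
  ring

end IsFirstHarmonic

end AngularMomentum

end SphereCalculus

section Radial

theorem fact_finrank_E3 : Fact (Module.finrank ℝ E3 = 2 + 1) := ⟨finrank_euclideanSpace_fin⟩

attribute [local instance] fact_finrank_E3

theorem norm_coe (x : S2) : ‖(x : E3)‖ = 1 := norm_eq_of_mem_sphere x

theorem coe_ne_zero (x : S2) : (x : E3) ≠ 0 := ne_zero_of_mem_unit_sphere x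

theorem coe_radial {y : E3} (hy : y ≠ 0) : (radial y : E3) = ‖y‖⁻¹ • y := by
  simp [radial, hy]

theorem radial_coe (x : S2) : radial (x : E3) = x := by
  apply Subtype.ext
  rw [coe_radial (coe_ne_zero x), norm_coe, inv_one, one_smul]

theorem radial_smul {t : ℝ} (ht : 0 < t) {y : E3} (hy : y ≠ 0) : radial (t • y) = radial y := by
  apply Subtype.ext
  rw [coe_radial hy, coe_radial (smul_ne_zero ht.ne' hy), norm_smul, Real.norm_of_nonneg ht.le,
    smul_smul, _root_.mul_inv_rev, inv_mul_cancel_right₀ ht.ne']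

theorem clm_apply_eq_sum (L : E3 →L[ℝ] ℝ) (v : E3) :
    L v = ∑ i, v i * L (EuclideanSpace.single i 1) := by
  conv_lhs => rw [← (EuclideanSpace.basisFun (Fin 3) ℝ).sum_repr v]
  simp [map_sum]

theorem hasFDerivAt_norm {y : E3} (hy : y ≠ 0) :
    HasFDerivAt (‖·‖) (‖y‖⁻¹ • innerSL ℝ y) y := by
  have h := (hasStrictFDerivAt_norm_sq y).hasFDerivAt.sqrt (by simpa using hy)
  simp only [Real.sqrt_sq (norm_nonneg _)] at h
  refine h.congr_fderiv ?_
  ext v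
  simp
  ring

theorem hasFDerivAt_norm_coe (x : S2) :
    HasFDerivAt (‖·‖) (innerSL ℝ (x : E3)) (x : E3) := by
  simpa [norm_coe] using hasFDerivAt_norm (coe_ne_zero x)

variable {F G : S2 → ℝ}

theorem Smooth.contDiffAt_radial (hF : Smooth F) {y : E3} (hy : y ≠ 0) :
    ContDiffAt ℝ ∞ (fun z => F (radial z)) y := by
  let U : TopologicalSpace.Opens E3 := ⟨{0}ᶜ, isOpen_compl_singleton⟩
  have normalize_smooth : ContMDiff 𝓘(ℝ, E3) 𝓘(ℝ, E3) ∞ fun z : U => ‖(z : E3)‖⁻¹ • (z : E3) := by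
    intro z
    have hz : (z : E3) ≠ 0 := z.2
    refine (contMDiffAt_subtype_iff (f := fun z : E3 => ‖z‖⁻¹ • z)).mpr ?_
    exact (((contDiffAt_norm ℝ hz).inv (norm_ne_zero_iff.mpr hz)).smul contDiffAt_id).contMDiffAt
  have normalize_mem (z : U) : ‖(z : E3)‖⁻¹ • (z : E3) ∈ Metric.sphere (0 : E3) 1 :=
    coe_radial z.2 ▸ (radial _).2
  have comp_smooth : ContMDiff 𝓘(ℝ, E3) 𝓘(ℝ, ℝ) ∞ fun z : U => F (radial z) := by
    convert ContMDiff.comp hF (normalize_smooth.codRestrict_sphere (n := 2) normalize_mem) using 2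
      with z
    exact congrArg F (Subtype.ext (coe_radial z.2))
  exact ((contMDiffAt_subtype_iff (f := fun z => F (radial z)) (x := (⟨y, hy⟩ : U))).mp
    (comp_smooth ⟨y, hy⟩)).contDiffAt

theorem Smooth.differentiableAt_radial (hF : Smooth F) {y : E3} (hy : y ≠ 0) :
    DifferentiableAt ℝ (fun z => F (radial z)) y :=
  (hF.contDiffAt_radial hy).differentiableAt (by simp)

theorem smooth_of_contDiffAt {g : E3 → ℝ} (hg : ∀ x : S2, ContDiffAt ℝ ∞ g x) :
    Smooth fun x : S2 => g x := fun x =>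
  ContMDiffAt.comp (I' := 𝓘(ℝ, E3)) x (hg x).contMDiffAt (contMDiff_coe_sphere (n := 2)).contMDiffAt

theorem smooth_coord (i : Fin 3) : Smooth fun x : S2 => (x : E3) i :=
  smooth_of_contDiffAt (g := fun y => y i) fun _ => by fun_prop

end Radial

section TangentialGradient

variable {F G : S2 → ℝ}

theorem Smooth.pd (hF : Smooth F) (i : Fin 3) : Smooth (pd F i) :=
  smooth_of_contDiffAt (g := fun y => fderiv ℝ (fun z => F (radial z)) y
    (EuclideanSpace.single i 1)) fun x =>
    ((hF.contDiffAt_radial (coe_ne_zero x)).fderiv_right (by simp)).clm_apply contDiffAt_const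

theorem pd_radial (F : S2 → ℝ) (i : Fin 3) {y : E3} (hy : y ≠ 0) :
    pd F i (radial y) =
      ‖y‖ * fderiv ℝ (fun z => F (radial z)) y (EuclideanSpace.single i 1) := by
  have ht : 0 < ‖y‖⁻¹ := inv_pos.mpr (norm_pos_iff.mpr hy)
  have homogeneous : (fun z => F (radial z)) =ᶠ[nhds y]
      fun z => (fun w => F (radial w)) (‖y‖⁻¹ • z) := by
    filter_upwards [isOpen_compl_singleton.mem_nhds hy] with z hz
    rw [radial_smul ht hz]
  rw [pd, homogeneous.fderiv_eq, fderiv_comp_smul (f := fun w => F (radial w)), ← coe_radial hy,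
    _root_.smul_apply, smul_eq_mul, mul_inv_cancel_left₀ (norm_ne_zero_iff.mpr hy)]

theorem sum_coord_mul_pd (hF : Smooth F) (x : S2) : ∑ i, (x : E3) i * pd F i x = 0 := by
  have ray : HasDerivAt (fun t : ℝ => t • (x : E3)) (x : E3) 1 := by
    simpa using (hasDerivAt_id (1 : ℝ)).smul_const (x : E3)
  have along_ray : HasDerivAt (fun t : ℝ => F (radial (t • (x : E3))))
      (fderiv ℝ (fun z => F (radial z)) x (x : E3)) 1 := by
    refine HasFDerivAt.comp_hasDerivAt (l := fun z => F (radial z)) 1 ?_ ray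
    rw [one_smul]
    exact (hF.differentiableAt_radial (coe_ne_zero x)).hasFDerivAt
  have const_along_ray : (fun t : ℝ => F (radial (t • (x : E3)))) =ᶠ[nhds 1] fun _ => F x := by
    filter_upwards [isOpen_Ioi.mem_nhds (zero_lt_one (α := ℝ))] with t ht
    rw [radial_smul ht (coe_ne_zero x), radial_coe]
  have directional : ∑ i, (x : E3) i * pd F i x = fderiv ℝ (fun z => F (radial z)) x (x : E3) :=
    (clm_apply_eq_sum _ _).symm
  rw [directional, ← along_ray.deriv, const_along_ray.deriv_eq, deriv_const]

theorem pd_coord (i j : Fin 3) (x : S2) :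
    pd (fun x : S2 => (x : E3) i) j x = (if i = j then 1 else 0) - (x : E3) i * (x : E3) j := by
  have normalize : (fun y : E3 => (radial y : E3) i) =ᶠ[nhds (x : E3)] fun y => ‖y‖⁻¹ * y i := by
    filter_upwards [isOpen_compl_singleton.mem_nhds (coe_ne_zero x)] with y hy
    simp [coe_radial hy]
  have hasFDerivAt_inv_norm :
      HasFDerivAt (fun y : E3 => ‖y‖⁻¹) (-(innerSL ℝ (x : E3))) (x : E3) := by
    refine ((hasDerivAt_inv (norm_ne_zero_iff.mpr (coe_ne_zero x))).comp_hasFDerivAt _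
      (hasFDerivAt_norm_coe x)).congr_fderiv ?_
    simp
  have hasFDerivAt_apply : HasFDerivAt (fun y : E3 => y i) (EuclideanSpace.proj i : E3 →L[ℝ] ℝ) x :=
    (EuclideanSpace.proj i : E3 →L[ℝ] ℝ).hasFDerivAt
  rw [pd, normalize.fderiv_eq, (hasFDerivAt_inv_norm.fun_mul hasFDerivAt_apply).fderiv]
  simp [PiLp.inner_apply, eq_comm]
  ring

theorem pd_add (hF : Smooth F) (hG : Smooth G) (i : Fin 3) (x : S2) :
    pd (fun x => F x + G x) i x = pd F i x + pd G i x := by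
  rw [pd, fderiv_fun_add (hF.differentiableAt_radial (coe_ne_zero x))
    (hG.differentiableAt_radial (coe_ne_zero x))]
  rfl

theorem pd_mul (hF : Smooth F) (hG : Smooth G) (i : Fin 3) (x : S2) :
    pd (fun x => F x * G x) i x = F x * pd G i x + G x * pd F i x := by
  rw [pd, fderiv_fun_mul (hF.differentiableAt_radial (coe_ne_zero x))
    (hG.differentiableAt_radial (coe_ne_zero x)), radial_coe]
  rfl

theorem pd_const (k : ℝ) (i : Fin 3) (x : S2) : pd (fun _ => k) i x = 0 := by
  simp [pd]

theorem pd_pd_sub (hF : Smooth F) (i j : Fin 3) (x : S2) :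
    pd (pd F i) j x - pd (pd F j) i x = (x : E3) j * pd F i x - (x : E3) i * pd F j x := by
  have hcd := hF.contDiffAt_radial (coe_ne_zero x)
  have second_derivative (i j : Fin 3) : pd (pd F i) j x = (x : E3) j * pd F i x +
      fderiv ℝ (fderiv ℝ fun z => F (radial z)) x (EuclideanSpace.single j 1)
        (EuclideanSpace.single i 1) := by
    have homogeneous : (fun y => pd F i (radial y)) =ᶠ[nhds (x : E3)] fun y => ‖y‖ *
        fderiv ℝ (fun z => F (radial z)) y (EuclideanSpace.single i 1) := by
      filter_upwards [isOpen_compl_singleton.mem_nhds (coe_ne_zero x)] with y hy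
      exact pd_radial F i hy
    have differentiable : DifferentiableAt ℝ (fderiv ℝ fun z => F (radial z)) (x : E3) :=
      (hcd.fderiv_right (m := 1) (by norm_cast)).differentiableAt one_ne_zero
    rw [pd, homogeneous.fderiv_eq, ((hasFDerivAt_norm_coe x).fun_mul
      (differentiable.hasFDerivAt.clm_apply (hasFDerivAt_const _ _))).fderiv]
    simp [PiLp.inner_apply, pd]
    ring
  have symmetric := hcd.isSymmSndFDerivAt (by simpa using by norm_cast)
    (EuclideanSpace.single i 1) (EuclideanSpace.single j 1)
  rw [second_derivative i j, second_derivative j i, symmetric]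
  ring

theorem exists_eq_const_of_pd_eq_zero (hF : Smooth F) (h : ∀ i x, pd F i x = 0) :
    ∃ k, ∀ x, F x = k := by
  have preconnected : IsPreconnected ({0}ᶜ : Set E3) := by
    refine (isConnected_compl_singleton_of_one_lt_rank ?_ 0).isPreconnected
    rw [← Module.finrank_eq_rank, finrank_euclideanSpace_fin]
    norm_num
  have fderiv_eq_zero {y : E3} (hy : y ≠ 0) : fderiv ℝ (fun z => F (radial z)) y = 0 := by
    ext v
    rw [clm_apply_eq_sum]
    refine Finset.sum_eq_zero fun i _ => mul_eq_zero_of_right _ ?_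
    have hi := pd_radial F i hy
    rw [h, zero_eq_mul] at hi
    exact hi.resolve_left (norm_ne_zero_iff.mpr hy)
  obtain ⟨k, hk⟩ := isOpen_compl_singleton.exists_is_const_of_fderiv_eq_zero preconnected
    (fun y hy => (hF.differentiableAt_radial hy).differentiableWithinAt)
    fun y hy => fderiv_eq_zero hy
  exact ⟨k, fun x => by simpa only [radial_coe] using hk x (coe_ne_zero x)⟩

end TangentialGradient

section Integration

theorem Smooth.integrable {F : S2 → ℝ} (hF : Smooth F) :
    Integrable F (volume : Measure E3).toSphere :=
  (ContMDiff.continuous hF).integrable_of_hasCompactSupport (.of_compactSpace F)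

theorem sint_one :
    sint (fun _ => 1) = 3 * (volume : Measure E3).real (Metric.ball 0 1) := by
  rw [sint, integral_const, smul_eq_mul, mul_one, Measure.toSphere_real_apply_univ,
    finrank_euclideanSpace_fin, Nat.cast_ofNat]

theorem sint_one_pos : 0 < sint fun _ => 1 := by
  rw [sint_one]
  have ball_pos := ENNReal.toReal_pos (Metric.measure_ball_pos volume (0 : E3) one_pos).ne'
    measure_ball_lt_top.ne
  exact mul_pos three_pos ball_pos

theorem integral_polar (p : ℝ → ℝ) (F : S2 → ℝ) :
    ∫ y : E3, p ‖y‖ * F (radial y) = (∫ r in Ioi (0 : ℝ), r ^ 2 * p r) * sint F := by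
  have hdim : Module.finrank ℝ E3 = 3 := finrank_euclideanSpace_fin
  have product (F : S2 → ℝ) : ∫ y : E3, p ‖y‖ * F (radial y) =
      sint F * ∫ r : Ioi (0 : ℝ), p r ∂(Measure.volumeIoiPow 2) := by
    have hmp := (volume : Measure E3).measurePreserving_homeomorphUnitSphereProd
    rw [hdim] at hmp
    let P : S2 × Ioi (0 : ℝ) → ℝ := fun z => F z.1 * p z.2
    calc ∫ y : E3, p ‖y‖ * F (radial y)
        = ∫ y : ({0}ᶜ : Set E3), p ‖(y : E3)‖ * F (radial y) ∂(volume : Measure E3).comap (↑) := by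
          rw [integral_subtype_comap (measurableSet_singleton _).compl
            fun y : E3 => p ‖y‖ * F (radial y), restrict_compl_singleton]
      _ = ∫ y, P (homeomorphUnitSphereProd E3 y) ∂(volume : Measure E3).comap (↑) := by
          refine integral_congr_ae (.of_forall fun y => ?_)
          have hy : (homeomorphUnitSphereProd E3 y).1 = radial (y : E3) :=
            Subtype.ext (by rw [coe_radial y.2, homeomorphUnitSphereProd_apply_fst_coe])
          simp only [P, hy, homeomorphUnitSphereProd_apply_snd_coe, mul_comm]
      _ = ∫ z, P z ∂(volume : Measure E3).toSphere.prod (Measure.volumeIoiPow 2) :=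
          hmp.integral_comp (Homeomorph.measurableEmbedding _) P
      _ = _ := integral_prod_mul F fun r : Ioi (0 : ℝ) => p r
  -- The radial factor does not involve `F`, so it can be read off from the case `F = 1`.
  have radial_part := product fun _ => 1
  simp only [mul_one] at radial_part
  rw [integral_fun_norm_addHaar, hdim, nsmul_eq_mul, smul_eq_mul, ← mul_assoc, Nat.cast_ofNat,
    ← sint_one] at radial_part
  simp only [smul_eq_mul, Nat.add_one_sub_one] at radial_part
  rw [product, mul_comm, mul_left_cancel₀ sint_one_pos.ne' radial_part]

theorem integral_Ioi_of_support_subset {p : ℝ → ℝ} {a b : ℝ} (ha : 0 < a)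
    (hp : Function.support p ⊆ Icc a b) : ∫ r in Ioi 0, p r = ∫ r, p r :=
  setIntegral_eq_integral_of_forall_compl_eq_zero fun _ hr =>
    Function.notMem_support.mp fun h => hr (ha.trans_le (hp h).1)

theorem exists_radial_cutoff :
    ∃ q : ℝ → ℝ, ContDiff ℝ ∞ q ∧ Function.support q ⊆ Icc 1 3 ∧
      ∫ r in Ioi (0 : ℝ), r ^ 2 * q r ≠ 0 := by
  obtain ⟨q, hq⟩ : ∃ q : ContDiffBump (2 : ℝ), q.rOut = 1 :=
    ⟨⟨1 / 2, 1, by norm_num, by norm_num⟩, rfl⟩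
  have support_subset : Function.support q ⊆ Icc 1 3 := by
    rw [q.support_eq, hq, Real.ball_eq_Ioo]
    norm_num [Ioo_subset_Icc_self]
  refine ⟨q, q.contDiff, support_subset, ne_of_gt ?_⟩
  rw [integral_Ioi_of_support_subset one_pos
    ((Function.support_mul_subset_right _ _).trans support_subset)]
  refine Continuous.integral_pos_of_hasCompactSupport_nonneg_nonzero (x := 2)
    ((continuous_pow 2).mul q.continuous) q.hasCompactSupport.mul_left
    (fun r => mul_nonneg (sq_nonneg r) q.nonneg) ?_
  exact mul_ne_zero (by norm_num) (q.pos_of_mem_ball (Metric.mem_ball_self q.rOut_pos)).ne'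

variable {p : ℝ → ℝ} {F : S2 → ℝ} {a b : ℝ}

theorem contDiff_norm_mul_radial (hp : ContDiff ℝ ∞ p) (ha : 0 < a)
    (hsupp : Function.support p ⊆ Icc a b) (hF : Smooth F) :
    ContDiff ℝ ∞ fun y : E3 => p ‖y‖ * F (radial y) := by
  refine contDiff_iff_contDiffAt.mpr fun y => ?_
  rcases eq_or_ne y 0 with rfl | hy
  · have zero_near_origin : (fun y : E3 => p ‖y‖ * F (radial y)) =ᶠ[nhds 0] fun _ => 0 := by
      filter_upwards [Metric.ball_mem_nhds (0 : E3) ha] with z hz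
      have notMem : ‖z‖ ∉ Function.support p := fun h =>
        (hsupp h).1.not_gt (mem_ball_zero_iff.mp hz)
      rw [Function.notMem_support.mp notMem, zero_mul]
    exact contDiffAt_const.congr_of_eventuallyEq zero_near_origin
  · exact (hp.contDiffAt.comp y (contDiffAt_norm ℝ hy)).mul (hF.contDiffAt_radial hy)

theorem hasCompactSupport_norm_mul_radial (hsupp : Function.support p ⊆ Icc a b) (F : S2 → ℝ) :
    HasCompactSupport fun y : E3 => p ‖y‖ * F (radial y) := by
  refine .intro (isCompact_closedBall (0 : E3) b) fun y hy => ?_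
  rw [Function.notMem_support.mp fun h => hy (mem_closedBall_zero_iff.mpr (hsupp h).2), zero_mul]

theorem integrable_norm_mul_radial (hp : ContDiff ℝ ∞ p) (ha : 0 < a)
    (hsupp : Function.support p ⊆ Icc a b) (hF : Smooth F) :
    Integrable fun y : E3 => p ‖y‖ * F (radial y) :=
  (contDiff_norm_mul_radial hp ha hsupp hF).continuous.integrable_of_hasCompactSupport
    (hasCompactSupport_norm_mul_radial hsupp F)

theorem fderiv_norm_mul_radial (hp : Differentiable ℝ p) (hF : Smooth F) {y : E3} (hy : y ≠ 0)
    (i : Fin 3) :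
    fderiv ℝ (fun y : E3 => p ‖y‖ * F (radial y)) y (EuclideanSpace.single i 1) =
      deriv p ‖y‖ * ((radial y : E3) i * F (radial y)) + p ‖y‖ / ‖y‖ * pd F i (radial y) := by
  have hnorm := (hp ‖y‖).hasDerivAt.comp_hasFDerivAt y (hasFDerivAt_norm hy)
  have hderiv := hnorm.mul (hF.differentiableAt_radial hy).hasFDerivAt
  rw [pd_radial F i hy, ← mul_assoc (p ‖y‖ / ‖y‖), div_mul_cancel₀ _ (norm_ne_zero_iff.mpr hy),
    coe_radial hy]
  refine (DFunLike.congr_fun hderiv.fderiv _).trans ?_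
  simp [PiLp.inner_apply]
  ring

theorem integral_fderiv_eq_zero {H : E3 → ℝ} (hH : ContDiff ℝ 1 H) (hc : HasCompactSupport H)
    (v : E3) : ∫ y, fderiv ℝ H y v = 0 := by
  have integrable_fderiv : Integrable fun y => fderiv ℝ H y v :=
    ((hH.continuous_fderiv one_ne_zero).clm_apply continuous_const).integrable_of_hasCompactSupport
      (hc.fderiv_apply ℝ v)
  simpa using integral_mul_fderiv_eq_neg_fderiv_mul_of_integrable (μ := (volume : Measure E3))
    (f := fun _ => (1 : ℝ)) (g := H) (v := v) (by simp) (by simpa using integrable_fderiv)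
    (by simpa using hH.continuous.integrable_of_hasCompactSupport hc) (by simp)
    fun y _ => hH.differentiable one_ne_zero y

theorem integral_sq_mul_deriv (hp : ContDiff ℝ 1 p) (hc : HasCompactSupport p) :
    ∫ r, r ^ 2 * deriv p r = -2 * ∫ r, r * p r := by
  have continuous_deriv := hp.continuous_deriv le_rfl
  have integrable_deriv : Integrable fun r => r ^ 2 * deriv p r :=
    ((continuous_pow 2).mul continuous_deriv).integrable_of_hasCompactSupport hc.deriv.mul_left
  have integrable_mul : Integrable fun r => 2 * (r * p r) :=
    ((continuous_id.mul hp.continuous).integrable_of_hasCompactSupport hc.mul_left).const_mul 2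
  have hderiv (r : ℝ) :
      HasDerivAt (fun r => r ^ 2 * p r) (2 * (r * p r) + r ^ 2 * deriv p r) r := by
    refine ((hasDerivAt_pow 2 r).fun_mul
      (hp.differentiable one_ne_zero r).hasDerivAt).congr_deriv ?_
    norm_num
    ring
  have total : ∫ r, 2 * (r * p r) + r ^ 2 * deriv p r = 0 :=
    integral_eq_zero_of_hasDerivAt_of_integrable hderiv (integrable_mul.add integrable_deriv)
      (((continuous_pow 2).mul hp.continuous).integrable_of_hasCompactSupport hc.mul_left)
  rw [integral_add integrable_mul integrable_deriv, integral_const_mul] at total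
  linarith

theorem support_deriv_subset_Icc (hsupp : Function.support p ⊆ Icc a b) :
    Function.support (deriv p) ⊆ Icc a b :=
  support_deriv_subset.trans (closure_minimal hsupp isClosed_Icc)

theorem integral_Ioi_sq_mul_deriv (hp : ContDiff ℝ 1 p) (ha : 0 < a)
    (hsupp : Function.support p ⊆ Icc a b) :
    ∫ r in Ioi 0, r ^ 2 * deriv p r = -2 * ∫ r in Ioi 0, r * p r := by
  rw [integral_Ioi_of_support_subset ha
      ((Function.support_mul_subset_right _ _).trans (support_deriv_subset_Icc hsupp)),
    integral_Ioi_of_support_subset ha ((Function.support_mul_subset_right _ _).trans hsupp),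
    integral_sq_mul_deriv hp (.of_support_subset_isCompact isCompact_Icc hsupp)]

/-- One integrates a derivative of the compactly supported function `p ‖y‖ * F (y / ‖y‖)` in polar
coordinates; the factor `2`, the mean curvature of the sphere, comes from the Jacobian `r ^ 2`. -/
theorem sint_pd (hF : Smooth F) (i : Fin 3) :
    sint (pd F i) = 2 * sint (fun x => (x : E3) i * F x) := by
  obtain ⟨q, hq, hsupp, hne⟩ := exists_radial_cutoff
  let p : ℝ → ℝ := fun r => r * q r
  have hp : ContDiff ℝ ∞ p := contDiff_id.mul hq
  have hsupp_p : Function.support p ⊆ Icc 1 3 := (Function.support_mul_subset_right _ _).trans hsupp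
  have hderiv : ∀ᵐ y : E3, fderiv ℝ (fun y : E3 => p ‖y‖ * F (radial y)) y
      (EuclideanSpace.single i 1) = deriv p ‖y‖ * ((radial y : E3) i * F (radial y)) +
        q ‖y‖ * pd F i (radial y) := by
    filter_upwards [compl_mem_ae_iff.mpr (measure_singleton (0 : E3))] with y hy
    rw [fderiv_norm_mul_radial (hp.differentiable (by simp)) hF hy,
      mul_div_cancel_left₀ _ (norm_ne_zero_iff.mpr hy)]
  have radial_parts : ∫ r in Ioi 0, r ^ 2 * deriv p r = -2 * ∫ r in Ioi 0, r ^ 2 * q r := by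
    rw [integral_Ioi_sq_mul_deriv (hp.of_le (by norm_cast)) one_pos hsupp_p]
    simp only [p, sq, mul_assoc]
  have divergence := integral_fderiv_eq_zero
    ((contDiff_norm_mul_radial hp one_pos hsupp_p hF).of_le (by norm_cast))
    (hasCompactSupport_norm_mul_radial hsupp_p F) (EuclideanSpace.single i 1)
  have smooth_coord_mul : Smooth fun x => (x : E3) i * F x := ContMDiff.mul (smooth_coord i) hF
  rw [integral_congr_ae hderiv, integral_add
    (integrable_norm_mul_radial (contDiff_infty_iff_deriv.mp hp).2 one_pos
      (support_deriv_subset_Icc hsupp_p) smooth_coord_mul)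
    (integrable_norm_mul_radial hq one_pos hsupp (hF.pd i)),
    integral_polar (deriv p) fun x : S2 => (x : E3) i * F x, integral_polar, radial_parts]
    at divergence
  refine mul_left_cancel₀ hne ?_
  linarith

end Integration

section SmoothFunctions

/-- The algebra of smooth functions on the sphere. -/
abbrev SmoothFn := ContMDiffMap (𝓡 2) 𝓘(ℝ, ℝ) S2 ℝ ∞

theorem SmoothFn.smooth (F : SmoothFn) : Smooth F := F.contMDiff

instance : CanLift (S2 → ℝ) SmoothFn (⇑) Smooth := ⟨fun F hF => ⟨⟨F, hF⟩, rfl⟩⟩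

/-- Evaluation at a point, as an algebra homomorphism. -/
def ev (x : S2) : SmoothFn →ₐ[ℝ] ℝ := (Pi.evalAlgHom ℝ _ x).comp ContMDiffMap.coeFnAlgHom

theorem ev_apply (x : S2) (F : SmoothFn) : ev x F = F x := rfl

theorem ext_ev {F G : SmoothFn} (h : ∀ x, ev x F = ev x G) : F = G := ContMDiffMap.ext h

/-- The `i`-th component of the tangential gradient as a derivation of the algebra of smooth
functions. -/
def pdDerivation (i : Fin 3) : Derivation ℝ SmoothFn SmoothFn :=
  .mk'
    { toFun := fun F => ⟨pd F i, F.smooth.pd i⟩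
      map_add' := fun F G => ContMDiffMap.ext fun x => pd_add F.smooth G.smooth i x
      map_smul' := fun k F => ContMDiffMap.ext fun x => by
        have h := pd_mul (smooth_of_contDiffAt (g := fun _ => k) fun _ => contDiffAt_const)
          F.smooth i x
        rwa [pd_const, mul_zero, add_zero] at h }
    fun F G => ContMDiffMap.ext fun x => pd_mul F.smooth G.smooth i x

/-- Integration over the sphere as a linear functional on smooth functions. -/
def sintLinear : SmoothFn →ₗ[ℝ] ℝ where
  toFun F := sint F
  map_add' F G := integral_add F.smooth.integrable G.smooth.integrable
  map_smul' k _ := integral_const_mul k _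

/-- The Cartesian coordinates as smooth functions on the sphere. -/
def coordFn (i : Fin 3) : SmoothFn := ⟨fun x => (x : E3) i, smooth_coord i⟩

/-- Calculus on the unit sphere in Euclidean three-space. -/
def sph : SphereCalculus SmoothFn where
  X := coordFn
  d := pdDerivation
  I := sintLinear
  X_dotProduct_X := ext_ev fun x => by
    have h := EuclideanSpace.real_norm_sq_eq (x : E3)
    rw [norm_coe, one_pow] at h
    simp only [dotProduct, map_sum, map_one, ← pow_two]
    exact h.symm
  d_X i j := ext_ev fun x => by
    rw [map_sub, map_mul, one_apply, apply_ite (ev x), map_one, map_zero]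
    exact pd_coord i j x
  X_dotProduct_d F := ext_ev fun x => by
    simp only [dotProduct, map_sum, map_mul, map_zero]
    exact sum_coord_mul_pd F.smooth x
  d_d_sub i j F := ext_ev fun x => by
    simp only [map_sub, map_mul]
    exact pd_pd_sub F.smooth i j x
  I_d i F := sint_pd F.smooth i

theorem I_eq (F : SmoothFn) : sph.I F = sint F := rfl

theorem ev_X (x : S2) (i : Fin 3) : ev x (sph.X i) = (x : E3) i := rfl

theorem ev_d (x : S2) (i : Fin 3) (F : SmoothFn) : ev x (sph.d i F) = pd F i x := rfl

theorem ev_met (x : S2) (i j : Fin 3) : ev x (sph.met i j) = met x i j := by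
  rw [SphereCalculus.met, Matrix.sub_apply, one_apply, vecMulVec_apply, map_sub, map_mul, ev_X,
    ev_X, apply_ite (ev x), map_one, map_zero, met]

theorem ev_eps (x : S2) (i j : Fin 3) : ev x (sph.eps i j) = eps x i j := by
  rw [SphereCalculus.eps, crossMatrix, of_apply, AlgHom.map_det, eps]
  congr 1
  ext a k
  fin_cases a <;> simp [Pi.single_apply, ev_X, apply_ite (ev x)]

end SmoothFunctions

section Fields

/-- The vector field with smooth Cartesian components `v i`. -/
def vectorField (v : Fin 3 → SmoothFn) : S2 → Fin 3 → ℝ := fun x i => v i x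

/-- The tensor field of rank two with smooth Cartesian components `T i j`. -/
def tensorField (T : Matrix (Fin 3) (Fin 3) SmoothFn) : S2 → Fin 3 → Fin 3 → ℝ :=
  fun x i j => T i j x

theorem cov1_vectorField (v : Fin 3 → SmoothFn) :
    cov1 (vectorField v) = tensorField (sph.cov1 v) := by
  funext x i j
  rw [tensorField, ← ev_apply, SphereCalculus.cov1_apply, mul_apply, map_sum]
  simp only [map_mul, ev_met]
  rfl

theorem hess_coe (F : SmoothFn) : hess F = tensorField (sph.hess F) :=
  cov1_vectorField (sph.grad F)

theorem lap_coe (F : SmoothFn) : lap F = sph.lap F := by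
  funext x
  rw [← ev_apply, SphereCalculus.lap_apply, trace, map_sum, lap, hess_coe]
  rfl

theorem lapLap_coe (F : SmoothFn) : lapLap F = sph.lapLap F := by
  have lapTwo_coe : (fun x => lap F x + 2 * F x) = sph.lapTwo F := by
    funext x
    rw [← ev_apply x (sph.lapTwo F), SphereCalculus.lapTwo_apply, map_add, map_mul, map_ofNat,
      lap_coe]
    rfl
  rw [lapLap, lapTwo_coe, lap_coe]
  rfl

theorem sum_met_mul_pd {F : S2 → ℝ} (hF : Smooth F) (x : S2) (i : Fin 3) :
    ∑ j, met x j i * pd F j x = pd F i x := by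
  have tangent := sum_coord_mul_pd hF x
  simp only [met, sub_mul, ite_mul, one_mul, zero_mul, Finset.sum_sub_distrib,
    Finset.sum_ite_eq', Finset.mem_univ, if_true, mul_right_comm _ _ (pd F _ x),
    ← Finset.sum_mul, tangent, sub_zero]

theorem div2_tensorField (T : Matrix (Fin 3) (Fin 3) SmoothFn) :
    div2 (tensorField T) = vectorField (sph.div2 T) := by
  funext x i
  calc div2 (tensorField T) x i
      = ∑ j, ∑ k, met x i k * ∑ l, met x j l * pd (T k l) j x := by
        simp only [div2, cov2, Finset.mul_sum, mul_assoc]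
        rfl
    _ = ∑ k, met x i k * ∑ l, ∑ j, met x j l * pd (T k l) j x := by
        rw [Finset.sum_comm]
        exact Finset.sum_congr rfl fun k _ => by rw [← Finset.mul_sum, Finset.sum_comm]
    _ = ∑ k, met x i k * ∑ l, pd (T k l) l x := by
        simp only [sum_met_mul_pd (SmoothFn.smooth _)]
    _ = ev x (sph.div2 T i) := by
        rw [SphereCalculus.div2_apply, mulVec, dotProduct, map_sum]
        simp only [map_mul, ev_met, SphereCalculus.rowDiv, LinearMap.coe_mk, AddHom.coe_mk,
          map_sum, ev_d]

theorem divdiv_tensorField (T : Matrix (Fin 3) (Fin 3) SmoothFn) :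
    divdiv (tensorField T) = sph.divdiv T := by
  funext x
  rw [divdiv, div2_tensorField, cov1_vectorField]
  exact (map_sum (ev x) (fun i => sph.cov1 (sph.div2 T) i i) _).symm

theorem tensorField_shear (F : SmoothFn) (x : S2) (i j : Fin 3) :
    tensorField (sph.shear F) x i j = 2 * hess F x i j - met x i j * lap F x := by
  rw [hess_coe, lap_coe, ← ev_met, mul_comm (ev x _)]
  rfl

theorem tensorField_shearOfPotentials (c b : SmoothFn) (x : S2) (i j : Fin 3) :
    tensorField (sph.shearOfPotentials c b) x i j = 2 * hess c x i j - met x i j * lap c x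
      + ∑ k, eps x i k * hess b x k j + ∑ k, eps x j k * hess b x k i := by
  rw [← tensorField_shear, hess_coe, add_assoc]
  have h : ∀ i j, ev x ((sph.eps * sph.hess b) i j) =
      ∑ k, eps x i k * tensorField (sph.hess b) x k j := fun i j => by
    rw [mul_apply, map_sum]
    simp only [map_mul, ev_eps]
    rfl
  rw [← h, ← h]
  rfl

end Fields

section Potentials

theorem coe_X_dotProduct_const (a : E3) :
    ⇑(sph.X ⬝ᵥ fun i => algebraMap ℝ SmoothFn (a i)) = fun x : S2 => inner ℝ a (x : E3) := by
  funext x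
  rw [← ev_apply, dotProduct, map_sum, PiLp.inner_apply]
  exact Finset.sum_congr rfl fun i _ => by rw [map_mul, AlgHom.commutes, ev_X]; rfl

theorem IsDipole.smooth {n : S2 → ℝ} (hn : IsDipole n) : Smooth n := by
  obtain ⟨a, ha⟩ := hn
  rw [funext ha, ← coe_X_dotProduct_const]
  exact SmoothFn.smooth _

theorem exists_eq_algebraMap {F : SmoothFn} (hF : sph.grad F = 0) :
    ∃ k, F = algebraMap ℝ SmoothFn k := by
  obtain ⟨k, hk⟩ := exists_eq_const_of_pd_eq_zero F.smooth fun i x => by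
    rw [← ev_d, ← sph.grad_apply, hF, Pi.zero_apply, map_zero]
  exact ⟨k, ContMDiffMap.ext hk⟩

theorem isDipole_coe_iff {n : SmoothFn} : IsDipole n ↔ sph.IsFirstHarmonic n := by
  constructor
  · rintro ⟨a, ha⟩
    have n_eq : n = sph.X ⬝ᵥ fun i => algebraMap ℝ SmoothFn (a i) :=
      ContMDiffMap.ext fun x => (ha x).trans (congrFun (coe_X_dotProduct_const a) x).symm
    rw [n_eq]
    refine SphereCalculus.isFirstHarmonic_X_dotProduct (ext fun i j => ?_)
    exact (sph.d j).map_algebraMap (a i)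
  · intro hn
    have hconst := SphereCalculus.isFirstHarmonic_iff_jac_eq_zero.mp hn
    choose a ha using fun i => exists_eq_algebraMap (funext fun j => congrFun₂ hconst i j)
    have n_eq : n = sph.X ⬝ᵥ (sph.grad n + n • sph.X) := by
      rw [dotProduct_add, dotProduct_smul, sph.X_dotProduct_grad, sph.X_dotProduct_X, zero_add,
        smul_eq_mul, mul_one]
    refine ⟨WithLp.toLp 2 a, congrFun ?_⟩
    rw [← coe_X_dotProduct_const]
    exact congrArg _ (n_eq.trans (congrArg _ (funext ha)))

theorem noDipolePart_coe_iff {F : SmoothFn} :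
    NoDipolePart F ↔ ∀ n, sph.IsFirstHarmonic n → sph.I (F * n) = 0 := by
  constructor
  · exact fun h n hn => h n (isDipole_coe_iff.mpr hn)
  · intro h n hn
    lift n to SmoothFn using hn.smooth
    exact h n (isDipole_coe_iff.mp hn)

theorem eq_zero_of_I_eq_zero {F : SmoothFn} (hF : ∀ x, 0 ≤ ev x F) (hI : sph.I F = 0) : F = 0 := by
  have ae_zero := (integral_eq_zero_iff_of_nonneg hF F.smooth.integrable).mp hI
  exact ContMDiffMap.ext <| congrFun <|
    (Continuous.ae_eq_iff_eq _ F.smooth.continuous continuous_zero).mp ae_zero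

theorem eq_zero_of_mul_self {F : SmoothFn} (hF : F * F = 0) : F = 0 := ext_ev fun x => by
  have h := congrArg (ev x) hF
  rwa [map_mul, map_zero, mul_self_eq_zero] at h

theorem eq_zero_of_I_mul_self {F : SmoothFn} (hF : sph.I (F * F) = 0) : F = 0 :=
  eq_zero_of_mul_self <| eq_zero_of_I_eq_zero
    (fun x => by rw [map_mul]; exact mul_self_nonneg _) hF

theorem eq_zero_of_I_trace_mul_self {T : Matrix (Fin 3) (Fin 3) SmoothFn} (hT : T.IsSymm)
    (hI : sph.I (trace (T * T)) = 0) : T = 0 := by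
  have ev_trace : ∀ x, ev x (trace (T * T)) = ∑ i, ∑ j, ev x (T i j) ^ 2 := fun x => by
    simp only [trace, diag_apply, mul_apply, map_sum, map_mul, pow_two]
    exact Finset.sum_congr rfl fun i _ => Finset.sum_congr rfl fun j _ => by rw [hT.apply]
  have sum_nonneg : ∀ x i, 0 ≤ ∑ j, ev x (T i j) ^ 2 := fun x i =>
    Finset.sum_nonneg fun j _ => sq_nonneg _
  have trace_eq_zero := eq_zero_of_I_eq_zero
    (fun x => by rw [ev_trace]; exact Finset.sum_nonneg fun i _ => sum_nonneg x i) hI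
  refine ext fun i j => ext_ev fun x => ?_
  have h := ev_trace x
  rw [trace_eq_zero, map_zero, eq_comm, Fintype.sum_eq_zero_iff_of_nonneg (sum_nonneg x)] at h
  have hi := (Fintype.sum_eq_zero_iff_of_nonneg fun j => sq_nonneg _).mp (congrFun h i)
  simpa using congrFun hi j

theorem eq_zero_of_lapLap_eq_zero {g : SmoothFn} (hg : sph.lapLap g = 0)
    (h0 : NoMonopolePart g) (h1 : NoDipolePart g) : g = 0 := by
  have shear_eq_zero : sph.shear g = 0 := by
    refine eq_zero_of_I_trace_mul_self (sph.isShearType_shear g).isSymm ?_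
    rw [sph.I_trace_shear_mul_self, hg, mul_zero, map_zero, mul_zero]
  obtain ⟨k, hk⟩ := exists_eq_algebraMap
    (SphereCalculus.grad_lapTwo_eq_zero_of_shear_eq_zero shear_eq_zero)
  have hn := SphereCalculus.isFirstHarmonic_sub_of_shear_eq_zero shear_eq_zero hk
  have orthogonal := noDipolePart_coe_iff.mp h1 _ hn
  rw [mul_sub, map_sub, mul_comm g (algebraMap ℝ _ _), ← Algebra.smul_def, map_smul, I_eq g, h0,
    smul_zero, sub_zero] at orthogonal
  exact eq_zero_of_I_mul_self orthogonal

theorem IsElectricPotential.unique {T : S2 → Fin 3 → Fin 3 → ℝ} {c c' : S2 → ℝ}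
    (h : IsElectricPotential T c) (h' : IsElectricPotential T c') : c = c' := by
  lift c to SmoothFn using h.smooth
  lift c' to SmoothFn using h'.smooth
  have lapLap_eq : sph.lapLap c = sph.lapLap c' := ContMDiffMap.ext fun x => by
    rw [← lapLap_coe, ← lapLap_coe, h.eq, h'.eq]
  have noDipole := noDipolePart_coe_iff.mp h.noDipole
  have noDipole' := noDipolePart_coe_iff.mp h'.noDipole
  refine congrArg _ (sub_eq_zero.mp (eq_zero_of_lapLap_eq_zero ?_ ?_ ?_))
  · rw [map_sub, lapLap_eq, sub_self]
  · change sph.I (c - c') = 0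
    rw [map_sub, I_eq, I_eq, h.noMonopole, h'.noMonopole, sub_zero]
  · refine noDipolePart_coe_iff.mpr fun n hn => ?_
    rw [sub_mul, map_sub, noDipole n hn, noDipole' n hn, sub_zero]

theorem IsElectricPotential.electricPotential_eq {T : S2 → Fin 3 → Fin 3 → ℝ} {c : S2 → ℝ}
    (h : IsElectricPotential T c) : electricPotential T = c := by
  have exists_potential : ∃ c, IsElectricPotential T c := ⟨c, h⟩
  rw [electricPotential, dif_pos exists_potential]
  exact exists_potential.choose_spec.unique h

theorem ArePotentials.eq_tensorField {T : S2 → Fin 3 → Fin 3 → ℝ} {c b : SmoothFn}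
    (h : ArePotentials T c b) : T = tensorField (sph.shearOfPotentials c b) := by
  funext x i j
  rw [h.eq, tensorField_shearOfPotentials]

theorem ArePotentials.isElectricPotential {T : S2 → Fin 3 → Fin 3 → ℝ} {c b : S2 → ℝ}
    (h : ArePotentials T c b) : IsElectricPotential T c where
  smooth := h.smooth_c
  noMonopole := h.noMonopole_c
  noDipole := h.noDipole_c
  eq x := by
    lift c to SmoothFn using h.smooth_c
    lift b to SmoothFn using h.smooth_b
    rw [h.eq_tensorField, divdiv_tensorField, sph.divdiv_shearOfPotentials, lapLap_coe]

end Potentials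

section Supertranslation

theorem contMDiff_slice {I : Set ℝ} (hI : IsOpen I) {u : ℝ} (hu : u ∈ I) {F : ℝ × S2 → ℝ}
    (hF : ContMDiffOn (𝓘(ℝ, ℝ).prod (𝓡 2)) 𝓘(ℝ, ℝ) ∞ F (I ×ˢ univ)) :
    Smooth fun x => F (u, x) := fun x => by
  have h := (hF (u, x) ⟨hu, mem_univ x⟩).contMDiffAt
    ((hI.prod isOpen_univ).mem_nhds ⟨hu, mem_univ x⟩)
  exact ContMDiffAt.comp (I' := 𝓘(ℝ, ℝ).prod (𝓡 2)) x h
    (contMDiffAt_const.prodMk contMDiffAt_id)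

theorem div2_zero : div2 0 = 0 := by
  funext x i
  have pd_zero : ∀ k, pd (fun _ => 0) k x = 0 := fun k => pd_const 0 k x
  simp [div2, cov2, pd_zero]

namespace ScriData

variable {D : ScriData} {u : ℝ}

theorem χddot_eq_zero {I : Set ℝ} (hI : IsOpen I) (hχ : ∀ s ∈ I, D.χdot s = 0) (hu : u ∈ I) :
    D.χddot u = 0 := by
  funext x i j
  have h : (fun s => D.χdot s x i j) =ᶠ[nhds u] fun _ => 0 := by
    filter_upwards [hI.mem_nhds hu] with s hs
    rw [hχ s hs]
    rfl
  rw [χddot, h.deriv_eq, deriv_const]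
  rfl

theorem supertranslate_χ {χ : Matrix (Fin 3) (Fin 3) SmoothFn} (hχ : D.χ u = tensorField χ)
    (f : SmoothFn) : (D.supertranslate f).χ u = tensorField (χ - sph.shear f) := by
  funext x i j
  change D.χ u x i j - 2 * hess f x i j + met x i j * lap f x =
    tensorField χ x i j - tensorField (sph.shear f) x i j
  rw [tensorField_shear, hχ]
  ring

variable (hdot : D.χdot u = 0) (hddot : D.χddot u = 0)
include hdot hddot

theorem supertranslate_m (f : S2 → ℝ) : (D.supertranslate f).m u = D.m u := by
  funext x
  simp [supertranslate, hdot, hddot, div2_zero]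

theorem supertranslate_N {χ : Matrix (Fin 3) (Fin 3) SmoothFn} {m : SmoothFn}
    {N : Fin 3 → SmoothFn} (hχ : D.χ u = tensorField χ) (hm : D.m u = m)
    (hN : D.N u = vectorField N) (f : SmoothFn) :
    (D.supertranslate f).N u = vectorField (N - m • sph.grad f
      + (1 / 4 : ℝ) • (sph.cov1 (sph.div2 χ) - (sph.cov1 (sph.div2 χ))ᵀ) *ᵥ sph.grad f) := by
  funext x i
  let C := sph.cov1 (sph.div2 χ)
  have curl_eq : ev x (((C - Cᵀ) *ᵥ sph.grad f) i) =
      ∑ k, grad f x k * tensorField C x i k - ∑ k, grad f x k * tensorField C x k i := by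
    simp only [mulVec, dotProduct, map_sum, map_mul, Matrix.sub_apply, transpose_apply, map_sub,
      sub_mul, Finset.sum_sub_distrib, mul_comm (ev x (C _ _))]
    rfl
  simp only [supertranslate, hdot, hddot, hχ, hm, hN, div2_zero, div2_tensorField,
    cov1_vectorField, Pi.zero_apply, zero_mul, mul_zero, Finset.sum_const_zero, sub_zero, add_zero]
  rw [add_sub_assoc, ← mul_sub, ← curl_eq]
  rfl

end ScriData

theorem ArePotentials.supertranslate {D : ScriData} {u : ℝ} {c b f : S2 → ℝ}
    (h : ArePotentials (D.χ u) c b) (hf : Smooth f) (hfd : NoDipolePart f) :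
    ArePotentials ((D.supertranslate f).χ u)
      (fun x => c x - f x + sint f / sint fun _ => 1) b := by
  lift c to SmoothFn using h.smooth_c
  lift b to SmoothFn using h.smooth_b
  lift f to SmoothFn using hf
  let k := sint f / sint fun _ => 1
  have I_algebraMap_mul : ∀ F, sph.I (algebraMap ℝ SmoothFn k * F) = k * sph.I F := fun F => by
    rw [← Algebra.smul_def, map_smul, smul_eq_mul]
  change ArePotentials _ ⇑(c - f + algebraMap ℝ SmoothFn k) _
  refine ⟨SmoothFn.smooth _, b.smooth, ?_, ?_, h.noMonopole_b, h.noDipole_b, fun x i j => ?_⟩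
  · have I_const : k * sph.I 1 = sint f := div_mul_cancel₀ _ sint_one_pos.ne'
    change sph.I (c - f + algebraMap ℝ SmoothFn k) = 0
    rw [← mul_one (algebraMap ℝ SmoothFn k), map_add, map_sub, I_algebraMap_mul, I_const, I_eq c,
      I_eq f, h.noMonopole_c, zero_sub, neg_add_cancel]
  · refine noDipolePart_coe_iff.mpr fun n hn => ?_
    rw [add_mul, sub_mul, map_add, map_sub, I_algebraMap_mul,
      noDipolePart_coe_iff.mp h.noDipole_c n hn, noDipolePart_coe_iff.mp hfd n hn, hn.I_eq_zero,
      mul_zero, sub_zero, add_zero]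
  · rw [← tensorField_shearOfPotentials, ScriData.supertranslate_χ h.eq_tensorField,
      SphereCalculus.shearOfPotentials, SphereCalculus.shearOfPotentials, sph.shear_add_algebraMap,
      sph.shear_sub, sub_add_eq_add_sub]

end Supertranslation

section AngularMomentum

theorem angMomWith_coe (χ : Matrix (Fin 3) (Fin 3) SmoothFn) (m : SmoothFn) (N : Fin 3 → SmoothFn)
    (n c : SmoothFn) :
    angMomWith (tensorField χ) m (vectorField N) n c = sph.angMom χ m N n c := by
  have ev_rotationField : ∀ x (v : Fin 3 → SmoothFn), ev x (sph.rotationField n ⬝ᵥ v) =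
      ∑ i, ∑ k, eps x i k * grad n x k * ev x (v i) := fun x v => by
    simp only [SphereCalculus.rotationField, mulVec, dotProduct, map_sum, map_mul, ev_eps,
      Finset.sum_mul]
    rfl
  rw [angMomWith, angMomCJK, SphereCalculus.angMom, I_eq, I_eq]
  congr 3
  · funext x
    have ev_mulVec : ∀ i, ev x ((χ *ᵥ sph.div2 χ) i) =
        ∑ j, tensorField χ x i j * vectorField (sph.div2 χ) x j := fun i => by
      simp only [mulVec, dotProduct, map_sum, map_mul]
      rfl
    rw [← ev_apply, ev_rotationField, div2_tensorField]
    refine Finset.sum_congr rfl fun i _ => Finset.sum_congr rfl fun k _ => ?_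
    rw [← ev_mulVec, mul_assoc, mul_comm]
    rfl
  · funext x
    rw [← ev_apply x (m * _), map_mul, ev_rotationField]
    rfl

theorem angMomWith_add_const (χ : S2 → Fin 3 → Fin 3 → ℝ) (m : S2 → ℝ) (N : S2 → Fin 3 → ℝ)
    (n c : S2 → ℝ) (k : ℝ) :
    angMomWith χ m N n (fun x => c x + k) = angMomWith χ m N n c := by
  have grad_add_const : grad (fun x => c x + k) = grad c := by
    funext x i
    rw [grad, pd, fderiv_add_const]
    rfl
  rw [angMomWith, angMomWith, grad_add_const]

theorem ScriData.angMomWith_supertranslate {D : ScriData} {u : ℝ} (hdot : D.χdot u = 0)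
    (hddot : D.χddot u = 0) (hm : Smooth (D.m u)) (hN : ∀ i, Smooth fun x => D.N u x i)
    {c b f n : S2 → ℝ} (hcb : ArePotentials (D.χ u) c b) (hf : Smooth f) (hn : IsDipole n)
    (horth : sint (fun x => f x * ∑ i, grad n x i * grad (lapLap b) x i) = 0) :
    angMomWith ((D.supertranslate f).χ u) ((D.supertranslate f).m u) ((D.supertranslate f).N u) n
      (fun x => c x - f x) = angMomWith (D.χ u) (D.m u) (D.N u) n c := by
  lift c to SmoothFn using hcb.smooth_c
  lift b to SmoothFn using hcb.smooth_b
  lift f to SmoothFn using hf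
  lift n to SmoothFn using hn.smooth
  obtain ⟨m, hm⟩ : ∃ m : SmoothFn, D.m u = m := ⟨⟨D.m u, hm⟩, rfl⟩
  obtain ⟨N, hN⟩ : ∃ N, D.N u = vectorField N := ⟨fun i => ⟨_, hN i⟩, rfl⟩
  have hχ := hcb.eq_tensorField
  have horth' : sph.I (f * (sph.grad n ⬝ᵥ sph.grad (sph.lapLap b))) = 0 := by
    rw [lapLap_coe] at horth
    exact horth
  rw [supertranslate_χ hχ, supertranslate_m hdot hddot, supertranslate_N hdot hddot hχ hm hN, hχ,
    hm, hN, angMomWith_coe]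
  exact (angMomWith_coe _ _ _ _ (c - f)).trans <|
    (isDipole_coe_iff.mp hn).angMom_supertranslate c b f horth' m N

end AngularMomentum

end NullInfinity

end

theorem mainTheorem2 (I : Set ℝ) (hI : IsOpen I) (D : NullInfinity.ScriData)
    (hD : D.IsRegularOn I)
    (hχ : ∀ u ∈ I, ∀ x i j, D.χdot u x i j = 0)
    (n : NullInfinity.S2 → ℝ) (hn : NullInfinity.IsDipole n)
    (f : NullInfinity.S2 → ℝ) (hf : NullInfinity.Smooth f)
    (u : ℝ) (hu : u ∈ I)
    (c b : NullInfinity.S2 → ℝ) (hcb : NullInfinity.ArePotentials (D.χ u) c b)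
    (horth : NullInfinity.sint (fun x => f x *
      ∑ i, NullInfinity.grad n x i * NullInfinity.grad (NullInfinity.lapLap b) x i) = 0) :
    (NullInfinity.NoDipolePart f →
      (D.supertranslate f).angMom n u = D.angMom n u) ∧
    NullInfinity.angMomWith ((D.supertranslate f).χ u) ((D.supertranslate f).m u)
      ((D.supertranslate f).N u) n (fun x => c x - f x) = D.angMom n u := by
  have hdot : ∀ s ∈ I, D.χdot s = 0 := fun s hs => funext fun x => funext₂ (hχ s hs x)
  have hddot := NullInfinity.ScriData.χddot_eq_zero hI hdot hu
  have hm := NullInfinity.contMDiff_slice hI hu hD.smooth_m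
  have hN := fun i => NullInfinity.contMDiff_slice hI hu (hD.smooth_N i)
  have potential_eq := hcb.isElectricPotential.electricPotential_eq
  have key : NullInfinity.angMomWith ((D.supertranslate f).χ u) ((D.supertranslate f).m u)
      ((D.supertranslate f).N u) n (fun x => c x - f x) = D.angMom n u := by
    rw [NullInfinity.ScriData.angMom, potential_eq]
    exact NullInfinity.ScriData.angMomWith_supertranslate (hdot u hu) hddot hm hN hcb hf hn horth
  refine ⟨fun hfd => ?_, key⟩
  have potential_eq' := (hcb.supertranslate hf hfd).isElectricPotential.electricPotential_eq
  rw [← key, NullInfinity.ScriData.angMom, potential_eq', NullInfinity.angMomWith_add_const]
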